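/- Let $(M,J)$ be a compact complex manifold of complex dimension $n>2$, and let $g$ be a (smooth) Hermitian metric on $M$ with fundamental form $\omega(X,Y)=g(JX,Y)$. Let $J$ act on real $p$-forms by $(J\eta)(X_1,\dots,X_p)=(-1)^p\eta(JX_1,\dots,JX_p)$, let $d^c=-J^{-1}dJ$, let $\star$ be the Hodge operator of $g$ for the complex orientation, and let $\theta$ be the Lee form of $g$, that is, the unique $1$-form with $d(\omega^{n-1})=\theta\wedge\omega^{n-1}$. For $1\le k\le n-1$ the metric is called $k$-Gauduchon if $dd^c(\omega^k)\wedge\omega^{n-k-1}=0$, and it is called Gauduchon if $dd^c(\omega^{n-1})=0$. Then: (i) for every integer $k$ with $1\le k\le n-1$, the metric is $k$-Gauduchon if and only if $$(n-k-1)\,dJd\omega\wedge\omega^{n-2}=-(k-1)\,(n-2)!\;d\star\theta ;$$ (ii) if the metric is $k_1$-Gauduchon and $k_2$-Gauduchon for some $1\le k_1,k_2\le n-1$ with $k_1\neq k_2$, then it is $k$-Gauduchon for every $1\le k\le n-1$; in particular, it is Gauduchon. -/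

import Mathlib

open scoped Manifold ContDiff Nat

noncomputable section

namespace KGauduchon

/-! ### Linear algebra: wedge product, the model space `ℂⁿ`, its real frame and determinant -/

section LinearAlgebra

variable {V : Type*} [AddCommGroup V] [Module ℝ V] [TopologicalSpace V] {p q : ℕ}

/-- The tensor product `v ↦ α(v₁, …, v_p) β(v_{p+1}, …, v_{p+q})` of two alternating forms. -/
def tensor (α : V [⋀^Fin p]→L[ℝ] ℝ) (β : V [⋀^Fin q]→L[ℝ] ℝ) :
    ContinuousMultilinearMap ℝ (fun _ : Fin (p + q) => V) ℝ where
  toMultilinearMap := ((LinearMap.mul' ℝ ℝ).compMultilinearMap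
    (α.toMultilinearMap.domCoprod β.toMultilinearMap)).domDomCongr finSumFinEquiv
  cont := by
    change Continuous fun v : Fin (p + q) → V =>
      α (fun i => v (Fin.castAdd q i)) * β (fun j => v (Fin.natAdd p j))
    exact (α.cont.comp (by fun_prop)).mul (β.cont.comp (by fun_prop))

theorem tensor_apply (α : V [⋀^Fin p]→L[ℝ] ℝ) (β : V [⋀^Fin q]→L[ℝ] ℝ) (v : Fin (p + q) → V) :
    tensor α β v = α (fun i => v (Fin.castAdd q i)) * β (fun j => v (Fin.natAdd p j)) :=
  rfl

/-- The wedge product of real alternating forms. -/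
def wedge (α : V [⋀^Fin p]→L[ℝ] ℝ) (β : V [⋀^Fin q]→L[ℝ] ℝ) : V [⋀^Fin (p + q)]→L[ℝ] ℝ :=
  ((p ! : ℝ) * (q ! : ℝ))⁻¹ • (tensor α β).alternatization

theorem wedge_apply (α : V [⋀^Fin p]→L[ℝ] ℝ) (β : V [⋀^Fin q]→L[ℝ] ℝ) (v : Fin (p + q) → V) :
    wedge α β v = ((p ! : ℝ) * (q ! : ℝ))⁻¹ * ∑ σ : Equiv.Perm (Fin (p + q)),
      (Equiv.Perm.sign σ : ℝ) * (α (fun i => v (σ (Fin.castAdd q i))) *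
        β (fun j => v (σ (Fin.natAdd p j)))) := by
  simp [wedge, ContinuousMultilinearMap.alternatization_apply_apply, tensor_apply,
    Units.smul_def, zsmul_eq_mul]

/-- Transport of an alternating form along an equality of degrees. -/
def reindex (h : p = q) (α : V [⋀^Fin p]→L[ℝ] ℝ) : V [⋀^Fin q]→L[ℝ] ℝ :=
  { α.toAlternatingMap.domDomCongr (finCongr h) with
    cont := by
      change Continuous fun v : Fin q → V => α (fun i => v (finCongr h i))
      exact α.cont.comp (by fun_prop) }

/-- Insert `p` fixed vectors `u` into the first `p` arguments of an alternating form. -/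
def insertFirst (u : Fin p → V) (μ : V [⋀^Fin (p + q)]→L[ℝ] ℝ) : V [⋀^Fin q]→L[ℝ] ℝ where
  toFun v := μ (Fin.append u v)
  map_update_add' := by
    intro _ v i x y
    have h : ∀ z : V, Fin.append u (Function.update v i z)
        = Function.update (Fin.append u v) (Fin.natAdd p i) z := fun z => by
      funext k
      induction k using Fin.addCases with
      | left k => simp [Function.update_apply, Fin.ext_iff]; omega
      | right k => simp [Function.update_apply]
    simp only [h, μ.map_update_add]
  map_update_smul' := by
    intro _ v i c x
    have h : ∀ z : V, Fin.append u (Function.update v i z)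
        = Function.update (Fin.append u v) (Fin.natAdd p i) z := fun z => by
      funext k
      induction k using Fin.addCases with
      | left k => simp [Function.update_apply, Fin.ext_iff]; omega
      | right k => simp [Function.update_apply]
    simp only [h, μ.map_update_smul]
  map_eq_zero_of_eq' v i j hv hij :=
    μ.map_eq_zero_of_eq (Fin.append u v) (i := Fin.natAdd p i) (j := Fin.natAdd p j)
      (by simpa using hv) (by simpa using hij)
  cont := by
    refine μ.cont.comp (continuous_pi fun k => ?_)
    induction k using Fin.addCases with
    | left k => simpa using continuous_const
    | right k => simpa using continuous_apply k

end LinearAlgebra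

/-- The model space `ℂⁿ`. -/
abbrev Cn (n : ℕ) : Type := EuclideanSpace ℂ (Fin n)

/-- The real basis `(e₁, i e₁, e₂, i e₂, …, eₙ, i eₙ)` of `ℂⁿ`, in this order; it represents the
complex orientation. -/
def realBasis (n : ℕ) : Module.Basis (Fin (2 * n)) ℝ (Cn n) :=
  (Complex.basisOneI.smulTower (EuclideanSpace.basisFun (Fin n) ℂ).toBasis).reindex
    ((Equiv.prodComm (Fin 2) (Fin n)).trans
      (finProdFinEquiv.trans (finCongr (Nat.mul_comm n 2))))

/-- The standard volume form `dx₁ ∧ dy₁ ∧ ⋯ ∧ dxₙ ∧ dyₙ` of `ℂⁿ`. -/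
def stdVol (n : ℕ) : Cn n [⋀^Fin (2 * n)]→L[ℝ] ℝ :=
  { (realBasis n).det with
    cont := by
      change Continuous fun v : Fin (2 * n) → Cn n => (realBasis n).det v
      simp only [Module.Basis.det_apply]
      refine Continuous.matrix_det (continuous_matrix fun i j => ?_)
      simp only [Module.Basis.toMatrix_apply]
      exact (((realBasis n).coord i).continuous_of_finiteDimensional).comp (continuous_apply j) }

/-- Multiplication by `i` on `ℂⁿ`, as a real linear map. -/
def mulI (n : ℕ) : Cn n →L[ℝ] Cn n := Complex.I • ContinuousLinearMap.id ℝ (Cn n)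

theorem mulI_mulI {n : ℕ} (v : Cn n) : mulI n (mulI n v) = -v := by
  simp [mulI, smul_smul]

/-- The alternating form attached to a bilinear form `B` with `B v v = 0`. -/
def ofBilin {n : ℕ} (B : Cn n →L[ℝ] Cn n →L[ℝ] ℝ) (hB : ∀ v, B v v = 0) :
    Cn n [⋀^Fin 2]→L[ℝ] ℝ where
  toFun v := B (v 0) (v 1)
  map_update_add' := by
    intro _ v i x y
    fin_cases i <;> simp
  map_update_smul' := by
    intro _ v i c x
    fin_cases i <;> simp
  map_eq_zero_of_eq' v i j hv hij := by
    have h : v 0 = v 1 := by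
      fin_cases i <;> fin_cases j <;> simp_all
    simp [h, hB]
  cont := by
    change Continuous fun v : Fin 2 → Cn n => B (v 0) (v 1)
    fun_prop

/-! ### Complex manifolds, real differential forms and Hermitian metrics

A complex manifold of dimension `n` is a manifold `M` modelled on `ℂⁿ` with holomorphic transition
maps. The tangent space at `x` is identified by Mathlib with `ℂⁿ` through the preferred
(holomorphic) chart at `x`. -/

/-- A complex manifold is in particular a smooth (even analytic) real manifold. -/
instance isManifold_real {n : ℕ} {M : Type*} [TopologicalSpace M] [ChartedSpace (Cn n) M]
    [IsManifold 𝓘(ℂ, Cn n) ω M] : IsManifold 𝓘(ℝ, Cn n) ω M := by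
  refine isManifold_of_contDiffOn _ _ _ fun e e' he he' => ?_
  have h := (contDiffGroupoid ω 𝓘(ℂ, Cn n)).compatible he he'
  rw [contDiffGroupoid, mem_groupoid_of_pregroupoid] at h
  exact ContDiffOn.restrict_scalars ℝ h.1

section Manifold

variable {n : ℕ} {M : Type*} [TopologicalSpace M] [ChartedSpace (Cn n) M]

/-- The real tangent space of `M` at `x`. -/
abbrev Tan (n : ℕ) {M : Type*} [TopologicalSpace M] [ChartedSpace (Cn n) M] (x : M) : Type :=
  TangentSpace 𝓘(ℝ, Cn n) x

/-- The almost complex structure of `M`: multiplication by `i` in holomorphic coordinates. -/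
def cplxStr (x : M) : Tan n x →L[ℝ] Tan n x := mulI n

variable (n M) in
/-- Real differential `p`-forms on `M` (with no regularity imposed). -/
abbrev Form (p : ℕ) : Type _ := ∀ x : M, Tan n x [⋀^Fin p]→L[ℝ] ℝ

/-- Transport of a form along an equality of degrees. -/
def Form.cast {p q : ℕ} (h : p = q) (α : Form n M p) : Form n M q :=
  fun x => reindex h (α x)

/-- The wedge product of forms. -/
def Form.wedge {p q : ℕ} (α : Form n M p) (β : Form n M q) : Form n M (p + q) :=
  fun x => KGauduchon.wedge (α x) (β x)

/-- The powers `α ^ k = α ∧ ⋯ ∧ α` of a `2`-form; `α ^ 0` is the constant function `1`. -/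
def Form.pow (α : Form n M 2) : (k : ℕ) → Form n M (2 * k)
  | 0 => fun x => (ContinuousAlternatingMap.constOfIsEmpty ℝ (Tan n x) (Fin 0) (1 : ℝ))
  | k + 1 => (Form.pow α k).wedge α

/-- The coordinate expression of a form in the preferred chart `φ` at `x₀`, that is, its pullback
under `φ⁻¹`; it is meaningful on the (open) target of `φ`. -/
def Form.inChart {p : ℕ} (x₀ : M) (α : Form n M p) (y : Cn n) : Cn n [⋀^Fin p]→L[ℝ] ℝ :=
  (α ((chartAt (Cn n) x₀).symm y)).compContinuousLinearMap
    (mfderiv 𝓘(ℝ, Cn n) 𝓘(ℝ, Cn n) (chartAt (Cn n) x₀).symm y)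

/-- The exterior derivative: at `x`, differentiate the coordinate expression in the chart at `x`
and pull the result back to `M`. -/
def Form.d {p : ℕ} (α : Form n M p) : Form n M (p + 1) := fun x =>
  (extDeriv (α.inChart x) (chartAt (Cn n) x x)).compContinuousLinearMap
    (mfderiv 𝓘(ℝ, Cn n) 𝓘(ℝ, Cn n) (chartAt (Cn n) x) x)

/-- The action of the complex structure on `p`-forms,
`(J α)(X₁, …, X_p) = (-1)^p α(J X₁, …, J X_p)`; on forms of type `(p, q)` it is multiplication
by `i^(q-p)`. -/
def Form.J {p : ℕ} (α : Form n M p) : Form n M p :=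
  fun x => (-1 : ℝ) ^ p • (α x).compContinuousLinearMap (cplxStr x)

/-- The inverse of `J` on `p`-forms, `J⁻¹ = (-1)^p J`. -/
def Form.Jinv {p : ℕ} (α : Form n M p) : Form n M p :=
  fun x => (-1 : ℝ) ^ p • α.J x

/-- The operator `d^c = -J⁻¹ d J`. -/
def Form.dc {p : ℕ} (α : Form n M p) : Form n M (p + 1) := fun x => -(α.J.d.Jinv x)

variable (n M) in
/-- A (smooth) Hermitian metric: a smooth Riemannian metric `g` with `g(J v, J w) = g(v, w)`. -/
structure HermitianMetric [IsManifold 𝓘(ℂ, Cn n) ω M] extends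
    Bundle.ContMDiffRiemannianMetric 𝓘(ℝ, Cn n) ∞ (Cn n) (fun x : M => Tan n x) where
  /-- Compatibility with the complex structure. -/
  inner_cplxStr (x : M) (v w : Tan n x) :
    inner x (cplxStr x v) (cplxStr x w) = inner x v w

variable [IsManifold 𝓘(ℂ, Cn n) ω M] (g : HermitianMetric n M)

namespace HermitianMetric

theorem inner_cplxStr_self (x : M) (v : Tan n x) : g.inner x (cplxStr x v) v = 0 := by
  have h1 := g.inner_cplxStr x (cplxStr x v) v
  have h2 : cplxStr x (cplxStr x v) = -v := mulI_mulI v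
  have h3 := g.symm x v (cplxStr x v)
  rw [h2, map_neg, _root_.neg_apply] at h1
  linarith

/-- The fundamental form `ω(X, Y) = g(J X, Y)`. -/
def fundamentalForm : Form n M 2 := fun x =>
  ofBilin ((g.inner x : Cn n →L[ℝ] Cn n →L[ℝ] ℝ).comp (mulI n)) (g.inner_cplxStr_self x)

theorem fundamentalForm_apply (x : M) (v : Fin 2 → Tan n x) :
    g.fundamentalForm x v = g.inner x (cplxStr x (v 0)) (v 1) :=
  rfl

/-- The matrix of `g` at `x` in the coordinates of the preferred chart at `x`. -/
def gram (x : M) : Matrix (Fin (2 * n)) (Fin (2 * n)) ℝ :=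
  fun i j => g.inner x (realBasis n i) (realBasis n j)

/-- The Riemannian volume form of `g` for the complex orientation,
`√(det g) dx₁ ∧ dy₁ ∧ ⋯ ∧ dxₙ ∧ dyₙ`. -/
def vol : Form n M (2 * n) := fun x => (√(g.gram x).det • stdVol n : Cn n [⋀^Fin (2 * n)]→L[ℝ] ℝ)

/-- The Hodge operator `⋆` from `p`-forms to `(2n - p)`-forms, in coordinates
`(⋆ α)_{k₁ … k_q} = 1/p! ∑ g^{i₁ j₁} ⋯ g^{i_p j_p} α_{i₁ … i_p} vol_{j₁ … j_p k₁ … k_q}`.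
It is characterized by `β ∧ ⋆ α = ⟨β, α⟩ vol`. -/
def star {p q : ℕ} (h : 2 * n = p + q) (α : Form n M p) : Form n M q := fun x =>
  (p ! : ℝ)⁻¹ • ∑ i : Fin p → Fin (2 * n), ∑ j : Fin p → Fin (2 * n),
    ((∏ a, (g.gram x)⁻¹ (i a) (j a)) * α x (fun a => realBasis n (i a))) •
      insertFirst (V := Tan n x) (fun a => realBasis n (j a)) (g.vol.cast h x)

/-- `θ` is a Lee form of `g`: `d(ω^(n-1)) = θ ∧ ω^(n-1)`. -/
def IsLeeForm (θ : Form n M 1) : Prop :=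
  (g.fundamentalForm.pow (n - 1)).d =
    (θ.wedge (g.fundamentalForm.pow (n - 1))).cast (Nat.add_comm _ _)

/-- The Lee form of `g`: the `1`-form `θ` with `d(ω^(n-1)) = θ ∧ ω^(n-1)`. It exists and is unique
(for `n ≥ 2`), since `ω` is nondegenerate and so `θ ↦ θ ∧ ω^(n-1)` is bijective from `1`-forms to
`(2n-1)`-forms at each point. -/
def leeForm : Form n M 1 := Classical.epsilon g.IsLeeForm

/-- `g` is `k`-Gauduchon: `d d^c (ω^k) ∧ ω^(n-k-1) = 0`. -/
def IsKGauduchon (k : ℕ) : Prop :=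
  ((g.fundamentalForm.pow k).dc.d.wedge (g.fundamentalForm.pow (n - k - 1))) = 0

/-- `g` is Gauduchon: `d d^c (ω^(n-1)) = 0`. -/
def IsGauduchon : Prop := (g.fundamentalForm.pow (n - 1)).dc.d = 0

end HermitianMetric

end Manifold

end KGauduchon

end

/-!
### Why the statement holds

Write `ω` for the fundamental form, `A = dJdω ∧ ω^(n-2)` and `B = Jdω ∧ dω ∧ ω^(n-3)`. The operator
`J` is multiplicative and fixes `ω`, so that `d^c (ω^k) = J d (ω^k) = k Jdω ∧ ω^(k-1)`, and the
Leibniz rule gives `dd^c (ω^k) ∧ ω^(n-k-1) = k (A - (k-1) B)`. Hence the metric is `k`-Gauduchon if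
and only if `A = (k-1) B` (`HermitianMetric.isKGauduchon_iff`).

On the other hand `ωⁿ = n! vol` (`HermitianMetric.pow_co_fundamentalForm`), and contracting this
identity with the vector dual to `θ` gives `(n-1)! ⋆θ = Jθ ∧ ω^(n-1) = J(θ ∧ ω^(n-1))
= J d (ω^(n-1))` (`HermitianMetric.co_star_eq`). Another application of the Leibniz rule yields
`(n-2)! d⋆θ = A - (n-2) B` (`HermitianMetric.co_d_star_leeForm`). Inserting this into the equation
of part (i), the difference of its two sides becomes `(n-2) (A - (k-1) B)`, and `n > 2`. If
`A = (k-1) B` holds for two values of `k`, then `B = 0` and `A = 0`, which is part (ii).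

The computations take place in one graded algebra: an alternating form is encoded by its values on
lists of vectors (`Cochain`, `toCochain`), with a product defined by the recursion
`ι_v (f g) = (ι_v f) g ± f (ι_v g)` along lists. Associativity, graded commutativity and the Leibniz
rule are inductions on lists, without transport between degrees. The link with the given
definitions consists of `toCochain_wedge` and `toCochain_extDeriv`. On the manifold,
`Form.inChart_d` says that the exterior derivative may be computed in any chart, which gives the
differentiability of `dω` needed to differentiate twice.
-/

noncomputable section

namespace KGauduchon

/-! ### The algebra of cochains on lists of vectors -/

/-- Functions on finite lists of vectors. An alternating `p`-form is encoded by its values on lists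
of length `p`, extended by zero to the other lists (see `toCochain`). Forms of all degrees thus live
in one type, and equalities between forms need no transport along equalities of degrees. -/
def Cochain (V : Type*) : Type _ := List V → ℝ

namespace Cochain

variable {V : Type*}

instance : AddCommGroup (Cochain V) := inferInstanceAs (AddCommGroup (List V → ℝ))

instance : Module ℝ (Cochain V) := inferInstanceAs (Module ℝ (List V → ℝ))

@[ext] theorem ext {f g : Cochain V} (h : ∀ l, f l = g l) : f = g := funext h

@[simp] theorem zero_apply (l : List V) : (0 : Cochain V) l = 0 := rfl

@[simp] theorem add_apply (f g : Cochain V) (l : List V) : (f + g) l = f l + g l := rfl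

@[simp] theorem neg_apply (f : Cochain V) (l : List V) : (-f) l = -f l := rfl

@[simp] theorem sub_apply (f g : Cochain V) (l : List V) : (f - g) l = f l - g l := rfl

@[simp] theorem smul_apply (c : ℝ) (f : Cochain V) (l : List V) : (c • f) l = c * f l := rfl

/-- Insertion of a vector in the first argument (interior product). -/
def contr (v : V) : Cochain V →ₗ[ℝ] Cochain V where
  toFun f := fun l => f (v :: l)
  map_add' _ _ := rfl
  map_smul' _ _ := rfl

@[simp] theorem contr_apply (v : V) (f : Cochain V) (l : List V) : contr v f l = f (v :: l) := rfl

/-- The grading involution, equal to `(-1) ^ p` in degree `p`. -/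
def sgn : Cochain V →ₗ[ℝ] Cochain V where
  toFun f := fun l => (-1) ^ l.length * f l
  map_add' _ _ := by ext; exact mul_add _ _ _
  map_smul' _ _ := by ext; exact mul_left_comm _ _ _

@[simp] theorem sgn_apply (f : Cochain V) (l : List V) : sgn f l = (-1) ^ l.length * f l := rfl

@[simp] theorem sgn_sgn (f : Cochain V) : sgn (sgn f) = f := by
  ext l; simp [← mul_assoc, ← mul_pow]

theorem contr_sgn (v : V) (f : Cochain V) : contr v (sgn f) = -sgn (contr v f) := by
  ext l; simp [pow_succ]

/-- The product of cochains at a list, by the recursion which says that inserting a vector is an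
antiderivation. -/
def mulAux : List V → Cochain V → Cochain V → ℝ
  | [], f, g => f [] * g []
  | v :: l, f, g => mulAux l (contr v f) g + mulAux l (sgn f) (contr v g)

instance : Mul (Cochain V) := ⟨fun f g l => mulAux l f g⟩

open scoped Classical in
instance : One (Cochain V) := ⟨fun l => if l = [] then 1 else 0⟩

@[simp] theorem one_nil : (1 : Cochain V) [] = 1 := if_pos rfl

@[simp] theorem one_cons (v : V) (l : List V) : (1 : Cochain V) (v :: l) = 0 :=
  if_neg (List.cons_ne_nil v l)

@[simp] theorem contr_one (v : V) : contr v (1 : Cochain V) = 0 := by ext l; simp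

@[simp] theorem sgn_one : sgn (1 : Cochain V) = 1 := by
  ext l; cases l <;> simp

@[simp] theorem mul_nil (f g : Cochain V) : (f * g) [] = f [] * g [] := rfl

theorem mul_cons (f g : Cochain V) (v : V) (l : List V) :
    (f * g) (v :: l) = (contr v f * g) l + (sgn f * contr v g) l := rfl

theorem contr_mul (v : V) (f g : Cochain V) :
    contr v (f * g) = contr v f * g + sgn f * contr v g := rfl

protected theorem zero_mul (f : Cochain V) : 0 * f = 0 := by
  ext l
  induction l generalizing f with
  | nil => simp
  | cons v l ih => simpa [mul_cons] using by rw [ih, ih]; simp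

protected theorem mul_zero (f : Cochain V) : f * 0 = 0 := by
  ext l
  induction l generalizing f with
  | nil => simp
  | cons v l ih => simpa [mul_cons] using by rw [ih, ih]; simp

protected theorem add_mul (f g h : Cochain V) : (f + g) * h = f * h + g * h := by
  ext l
  induction l generalizing f g h with
  | nil => simp [_root_.add_mul]
  | cons v l ih =>
    simp only [mul_cons, map_add, ih, add_apply]
    ring

protected theorem mul_add (f g h : Cochain V) : f * (g + h) = f * g + f * h := by
  ext l
  induction l generalizing f g h with
  | nil => simp [_root_.mul_add]
  | cons v l ih =>
    simp only [mul_cons, map_add, ih, add_apply]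
    ring

protected theorem smul_mul (c : ℝ) (f g : Cochain V) : (c • f) * g = c • (f * g) := by
  ext l
  induction l generalizing f g with
  | nil => simp [mul_assoc]
  | cons v l ih =>
    simp only [mul_cons, map_smul, ih, smul_apply]
    ring

protected theorem mul_smul (c : ℝ) (f g : Cochain V) : f * (c • g) = c • (f * g) := by
  ext l
  induction l generalizing f g with
  | nil => simp [mul_left_comm]
  | cons v l ih =>
    simp only [mul_cons, map_smul, ih, smul_apply]
    ring

protected theorem neg_mul (f g : Cochain V) : -f * g = -(f * g) := by
  rw [← neg_one_smul ℝ f, Cochain.smul_mul, neg_one_smul]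

protected theorem mul_neg (f g : Cochain V) : f * -g = -(f * g) := by
  rw [← neg_one_smul ℝ g, Cochain.mul_smul, neg_one_smul]

protected theorem one_mul (f : Cochain V) : 1 * f = f := by
  ext l
  induction l generalizing f with
  | nil => simp
  | cons v l ih => simp [mul_cons, ih, Cochain.zero_mul]

protected theorem mul_one (f : Cochain V) : f * 1 = f := by
  ext l
  induction l generalizing f with
  | nil => simp
  | cons v l ih => simp [mul_cons, ih, Cochain.mul_zero]

theorem sgn_mul (f g : Cochain V) : sgn (f * g) = sgn f * sgn g := by
  ext l
  induction l generalizing f g with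
  | nil => simp
  | cons v l ih =>
    have h1 := ih (contr v f) g
    have h2 := ih (sgn f) (contr v g)
    simp only [sgn_apply, sgn_sgn] at h1 h2
    simp only [mul_cons, contr_sgn, Cochain.neg_mul, Cochain.mul_neg, neg_apply, sgn_sgn, ← h1,
      ← h2, sgn_apply, List.length_cons, pow_succ]
    ring

protected theorem mul_assoc (f g h : Cochain V) : f * g * h = f * (g * h) := by
  ext l
  induction l generalizing f g h with
  | nil => simp [_root_.mul_assoc]
  | cons v l ih =>
    simp only [mul_cons, contr_mul, sgn_mul, Cochain.add_mul, Cochain.mul_add, ih, add_apply]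
    ring

instance : Ring (Cochain V) where
  zero_mul := Cochain.zero_mul
  mul_zero := Cochain.mul_zero
  left_distrib := Cochain.mul_add
  right_distrib := Cochain.add_mul
  one_mul := Cochain.one_mul
  mul_one := Cochain.mul_one
  mul_assoc := Cochain.mul_assoc
  neg_add_cancel := neg_add_cancel
  zsmul := zsmulRec

instance : Algebra ℝ (Cochain V) := Algebra.ofModule Cochain.smul_mul Cochain.mul_smul

/-- Graded commutativity, for a homogeneous left factor. -/
theorem mul_apply_comm (l : List V) (f g : Cochain V) :
    (sgn f = f → (f * g) l = (g * f) l) ∧ (sgn f = -f → (f * g) l = (sgn g * f) l) := by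
  induction l generalizing f g with
  | nil => simp [mul_comm]
  | cons v l ih =>
    constructor
    · intro hf
      have h : sgn (contr v f) = -contr v f := by rw [← neg_eq_iff_eq_neg, ← contr_sgn, hf]
      rw [mul_cons, mul_cons, hf, (ih _ _).2 h, (ih _ _).1 hf, add_comm]
    · intro hf
      have h : sgn (contr v f) = contr v f := by
        rw [← neg_inj, ← contr_sgn, hf, map_neg]
      rw [mul_cons, mul_cons, hf, (ih _ _).1 h, contr_sgn, sgn_sgn, neg_mul, neg_mul, neg_apply,
        (ih _ _).2 hf, neg_apply, add_comm]

theorem commute_of_even {f : Cochain V} (hf : sgn f = f) (g : Cochain V) : Commute f g := by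
  ext l; exact (mul_apply_comm l f g).1 hf

theorem sgn_pow (f : Cochain V) (k : ℕ) : sgn (f ^ k) = sgn f ^ k := by
  induction k with
  | zero => simp
  | succ k ih => rw [pow_succ, pow_succ, sgn_mul, ih]

theorem contr_pow {f : Cochain V} (hf : sgn f = f) (v : V) (k : ℕ) :
    contr v (f ^ k) = (k : ℝ) • (contr v f * f ^ (k - 1)) := by
  induction k with
  | zero => simp
  | succ k ih =>
    have hc : f ^ (k - 1) * f = f ^ k ∨ (k : ℝ) = 0 := by
      cases k <;> simp [pow_succ]
    have h : (k : ℝ) • (contr v f * f ^ (k - 1) * f) = (k : ℝ) • (contr v f * f ^ k) := by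
      rcases hc with hc | hc
      · rw [mul_assoc, hc]
      · simp [hc]
    rw [pow_succ, contr_mul, ih, sgn_pow, hf, smul_mul_assoc, h,
      ((commute_of_even hf _).pow_left k).eq, Nat.add_sub_cancel]
    push_cast
    rw [add_smul, one_smul]

/-- A product whose left factor is a `1`-form vanishing on all listed vectors is zero there. -/
theorem mul_apply_eq_zero {a : Cochain V} (ha : ∀ l, l.length ≠ 1 → a l = 0) {l : List V}
    (h : ∀ v ∈ l, a [v] = 0) (f : Cochain V) : (a * f) l = 0 := by
  have hs : sgn a = -a := by
    ext l
    by_cases hl : l.length = 1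
    · simp [hl]
    · simp [ha l hl]
  induction l generalizing f with
  | nil => simp [ha [] (by simp)]
  | cons v l ih =>
    have hv : contr v a = 0 := by
      ext m
      cases m with
      | nil => exact h v (by simp)
      | cons u m => exact ha _ (by simp)
    rw [mul_cons, hv, hs, zero_mul, neg_mul, neg_apply, ih fun u hu => h u (by simp [hu])]
    simp

end Cochain

/-! ### The exterior derivative of cochain-valued functions -/

namespace Cochain

section Deriv

variable {E : Type*} [NormedAddCommGroup E] [NormedSpace ℝ E]

/-- The exterior derivative of a cochain-valued function. Inserting a constant vector `v` in `d f`
gives the derivative of `f` along `v` minus `d` of `f` with `v` inserted, and this recursion is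
taken as the definition. -/
def extD : (E → Cochain E) → E → Cochain E
  | _, _, [] => 0
  | f, y, v :: l => fderiv ℝ (fun z => f z l) y v - extD (fun z => contr v (f z)) y l

/-- The derivative of a cochain-valued function along `v`, list by list. -/
def dirD (v : E) (f : E → Cochain E) (y : E) : Cochain E := fun l => fderiv ℝ (fun z => f z l) y v

/-- Differentiability of a cochain-valued function, list by list. -/
def CDiffAt (f : E → Cochain E) (y : E) : Prop := ∀ l, DifferentiableAt ℝ (fun z => f z l) y

variable {f g : E → Cochain E} {y : E}

theorem contr_extD (v : E) (f : E → Cochain E) (y : E) :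
    contr v (extD f y) = dirD v f y - extD (fun z => contr v (f z)) y := rfl

theorem contr_dirD (u v : E) (f : E → Cochain E) (y : E) :
    contr u (dirD v f y) = dirD v (fun z => contr u (f z)) y := rfl

theorem CDiffAt.contr (hf : CDiffAt f y) (v : E) : CDiffAt (fun z => Cochain.contr v (f z)) y :=
  fun l => hf (v :: l)

theorem CDiffAt.sgn (hf : CDiffAt f y) : CDiffAt (fun z => Cochain.sgn (f z)) y :=
  fun l => (hf l).const_mul _

theorem CDiffAt.mul (hf : CDiffAt f y) (hg : CDiffAt g y) : CDiffAt (fun z => f z * g z) y := by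
  intro l
  induction l generalizing f g with
  | nil => exact DifferentiableAt.mul (hf []) (hg [])
  | cons v l ih => exact (ih (hf.contr v) hg).add (ih hf.sgn (hg.contr v))

theorem CDiffAt.smul (hf : CDiffAt f y) (c : ℝ) : CDiffAt (fun z => c • f z) y :=
  fun l => (hf l).const_mul c

theorem dirD_add (hf : CDiffAt f y) (hg : CDiffAt g y) (v : E) :
    dirD v (fun z => f z + g z) y = dirD v f y + dirD v g y := by
  ext l
  simp only [dirD, add_apply, fderiv_fun_add (hf l) (hg l), _root_.add_apply]

theorem dirD_sgn (hf : CDiffAt f y) (v : E) :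
    dirD v (fun z => sgn (f z)) y = sgn (dirD v f y) := by
  ext l
  simp [dirD, fderiv_const_mul (hf l)]

theorem dirD_mul (hf : CDiffAt f y) (hg : CDiffAt g y) (v : E) :
    dirD v (fun z => f z * g z) y = dirD v f y * g y + f y * dirD v g y := by
  ext l
  induction l generalizing f g with
  | nil =>
    simp only [dirD, mul_nil, add_apply]
    rw [fderiv_fun_mul (hf []) (hg [])]
    simp
    ring
  | cons u l ih =>
    change dirD v (fun z => contr u (f z * g z)) y l = _
    simp only [contr_mul]
    rw [dirD_add ((hf.contr u).mul hg) (hf.sgn.mul (hg.contr u)), add_apply, ih (hf.contr u) hg,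
      ih hf.sgn (hg.contr u), dirD_sgn hf]
    simp only [add_apply, mul_cons, contr_dirD]
    ring

theorem extD_add (hf : CDiffAt f y) (hg : CDiffAt g y) :
    extD (fun z => f z + g z) y = extD f y + extD g y := by
  ext l
  induction l generalizing f g with
  | nil => simp [extD]
  | cons v l ih =>
    have h := congrArg (fun c : Cochain E => c l) (dirD_add hf hg v)
    have h2 := ih (hf.contr v) (hg.contr v)
    simp only [← contr_apply, contr_extD, map_add, sub_apply, add_apply] at h h2 ⊢
    rw [h, h2]
    ring

theorem extD_const (f : Cochain E) (y : E) :
    extD (fun _ : E => f) y = 0 := by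
  ext l
  induction l generalizing f with
  | nil => rfl
  | cons v l ih => simpa [extD] using ih (contr v f)

theorem extD_smul (c : ℝ) (f : E → Cochain E)
    (y : E) (hf : CDiffAt f y) : extD (fun z => c • f z) y = c • extD f y := by
  ext l
  induction l generalizing f with
  | nil => simp [extD]
  | cons v l ih =>
    have h1 : extD (fun z => c • f z) y (v :: l) = fderiv ℝ (fun z => c • f z l) y v -
      extD (fun z => c • contr v (f z)) y l := rfl
    have h2 : extD f y (v :: l) = fderiv ℝ (fun z => f z l) y v -
      extD (fun z => contr v (f z)) y l := rfl
    rw [h1, ih _ (hf.contr v), smul_apply, smul_apply, h2, fderiv_fun_const_smul (hf l)]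
    simp [mul_sub]

theorem extD_sgn (hf : CDiffAt f y) : extD (fun z => sgn (f z)) y = -sgn (extD f y) := by
  ext l
  induction l generalizing f with
  | nil => simp [extD]
  | cons v l ih =>
    have h2 := ih (hf.contr v)
    have h3 : extD (fun z => -sgn (contr v (f z))) y = -extD (fun z => sgn (contr v (f z))) y := by
      have h := extD_smul (-1) _ _ (hf.contr v).sgn
      simpa only [neg_one_smul] using h
    change (dirD v (fun z => sgn (f z)) y - extD (fun z => contr v (sgn (f z))) y) l =
      contr v (-sgn (extD f y)) l
    rw [dirD_sgn hf, map_neg, contr_sgn, contr_extD, map_sub]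
    simp only [contr_sgn, h3, sub_apply, neg_apply, h2]
    ring

/-- The Leibniz rule. -/
theorem extD_mul (hf : CDiffAt f y) (hg : CDiffAt g y) :
    extD (fun z => f z * g z) y = extD f y * g y + sgn (f y) * extD g y := by
  ext l
  induction l generalizing f g with
  | nil => simp [extD]
  | cons v l ih =>
    have h : extD (fun z => contr v (f z * g z)) y l =
        (extD (fun z => contr v (f z)) y * g y + sgn (contr v (f y)) * extD g y +
        (-sgn (extD f y) * contr v (g y) + f y * extD (fun z => contr v (g z)) y)) l := by
      simp only [contr_mul]
      rw [extD_add ((hf.contr v).mul hg) (hf.sgn.mul (hg.contr v)), add_apply, ih (hf.contr v) hg,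
        ih hf.sgn (hg.contr v), extD_sgn hf, sgn_sgn]
      rfl
    change (dirD v (fun z => f z * g z) y - extD (fun z => contr v (f z * g z)) y) l =
      contr v (extD f y * g y + sgn (f y) * extD g y) l
    rw [sub_apply, h, dirD_mul hf hg, ← sub_apply, map_add, contr_mul, contr_mul, contr_extD,
      contr_extD, contr_sgn, sgn_sgn]
    refine congrArg (fun c : Cochain E => c l) ?_
    noncomm_ring

end Deriv

end Cochain

/-! ### Alternating forms as cochains -/

section ShuffleSum

variable {V : Type*} [AddCommGroup V] [Module ℝ V]

/-- The antisymmetrization of `α ⊗ β`, with the degree `m = p + q` of the result kept as an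
independent variable. -/
def altSum {p q m : ℕ} (h : p + q = m) (α : V [⋀^Fin p]→ₗ[ℝ] ℝ) (β : V [⋀^Fin q]→ₗ[ℝ] ℝ)
    (v : Fin m → V) : ℝ :=
  ∑ σ : Equiv.Perm (Fin m), (Equiv.Perm.sign σ : ℝ) *
    (α (fun i => v (σ (Fin.cast h (Fin.castAdd q i)))) *
      β (fun j => v (σ (Fin.cast h (Fin.natAdd p j)))))

/-- The permutations of `Fin (m + 1)`, sorted by the position `j` sent to `0`: composing with the
cycle `j.cycleRange` amounts to inserting the first vector at position `j`. -/
theorem sum_perm_succ {X : Type*} {m : ℕ} (T : (Fin (m + 1) → X) → ℝ) (x : X) (v : Fin m → X) :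
    ∑ σ : Equiv.Perm (Fin (m + 1)), (Equiv.Perm.sign σ : ℝ) * T ((Fin.cons x v : _ → X) ∘ σ) =
      ∑ e : Equiv.Perm (Fin m), (Equiv.Perm.sign e : ℝ) *
        ∑ j : Fin (m + 1), (-1) ^ (j : ℕ) * T (j.insertNth x (v ∘ e)) := by
  let F : Fin (m + 1) × Equiv.Perm (Fin m) → Equiv.Perm (Fin (m + 1)) :=
    fun a => Equiv.Perm.decomposeFin.symm (0, a.2) * a.1.cycleRange
  have hF : F.Bijective := by
    rw [Fintype.bijective_iff_injective_and_card]
    refine ⟨fun a b hab => ?_, Fintype.card_congr Equiv.Perm.decomposeFin.symm⟩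
    have h0 : ∀ a, (F a).symm 0 = a.1 := fun a => by
      rw [Equiv.symm_apply_eq]
      simp [F, Equiv.Perm.decomposeFin_symm_apply_zero]
    have h1 : a.1 = b.1 := by rw [← h0 a, hab, h0 b]
    have h2 : Equiv.Perm.decomposeFin.symm (0, a.2) = Equiv.Perm.decomposeFin.symm (0, b.2) := by
      have h3 := hab
      simp only [F, h1] at h3
      exact mul_right_cancel h3
    exact Prod.ext h1 (Prod.ext_iff.1 (Equiv.Perm.decomposeFin.symm.injective h2)).2
  rw [← hF.sum_comp, Fintype.sum_prod_type_right]
  refine Finset.sum_congr rfl fun e _ => ?_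
  rw [Finset.mul_sum]
  refine Finset.sum_congr rfl fun j _ => ?_
  have h : (Fin.cons x v : _ → X) ∘ F (j, e) = j.insertNth x (v ∘ e) := by
    rw [← Fin.cons_comp_cycleRange]
    funext i
    simp only [F, Function.comp_apply, Equiv.Perm.coe_mul]
    induction j.cycleRange i using Fin.cases with
    | zero => simp [Equiv.Perm.decomposeFin_symm_apply_zero]
    | succ k => simp [Equiv.Perm.decomposeFin_symm_apply_succ]
  rw [h]
  simp only [F, map_mul, Equiv.Perm.decomposeFin.symm_sign, Fin.sign_cycleRange]
  push_cast
  simp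
  ring

theorem sum_perm_succ_add {X : Type*} {p q m : ℕ} (h : p + q = m + 1)
    (T : (Fin (m + 1) → X) → ℝ) (x : X) (v : Fin m → X) :
    ∑ σ : Equiv.Perm (Fin (m + 1)), (Equiv.Perm.sign σ : ℝ) * T ((Fin.cons x v : _ → X) ∘ σ) =
      ∑ e : Equiv.Perm (Fin m), (Equiv.Perm.sign e : ℝ) *
        (∑ i : Fin p, (-1) ^ (i : ℕ) * T ((Fin.cast h (Fin.castAdd q i)).insertNth x (v ∘ e)) +
          ∑ i : Fin q, (-1) ^ (p + i : ℕ) *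
            T ((Fin.cast h (Fin.natAdd p i)).insertNth x (v ∘ e))) := by
  rw [sum_perm_succ]
  refine Finset.sum_congr rfl fun e _ => ?_
  rw [← (finCongr h).sum_comp, Fin.sum_univ_add]
  simp

theorem insertNth_castAdd_comp_castAdd {X : Type*} {p q m : ℕ} (h : p + 1 + q = m + 1)
    (h' : p + q = m) (i : Fin (p + 1)) (x : X) (v : Fin m → X) :
    (fun k => ((Fin.cast h (Fin.castAdd q i)).insertNth x v : _ → X)
      (Fin.cast h (Fin.castAdd q k))) =
    i.insertNth x (fun k => v (Fin.cast h' (Fin.castAdd q k))) := by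
  funext k
  induction k using i.succAboveCases with
  | x => simp
  | p k =>
    have : Fin.cast h (Fin.castAdd q (i.succAbove k)) =
        (Fin.cast h (Fin.castAdd q i)).succAbove (Fin.cast h' (Fin.castAdd q k)) := by
      ext; simp [Fin.succAbove, Fin.lt_def]; split <;> simp
    rw [this]; simp

theorem insertNth_castAdd_comp_natAdd {X : Type*} {p q m : ℕ} (h : p + 1 + q = m + 1)
    (h' : p + q = m) (i : Fin (p + 1)) (x : X) (v : Fin m → X) :
    (fun k => ((Fin.cast h (Fin.castAdd q i)).insertNth x v : _ → X)
      (Fin.cast h (Fin.natAdd (p + 1) k))) =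
    (fun k => v (Fin.cast h' (Fin.natAdd p k))) := by
  funext k
  have : Fin.cast h (Fin.natAdd (p + 1) k) =
      (Fin.cast h (Fin.castAdd q i)).succAbove (Fin.cast h' (Fin.natAdd p k)) := by
    ext; simp [Fin.succAbove, Fin.lt_def]; split <;> simp <;> omega
  rw [this]; simp

theorem insertNth_natAdd_comp_castAdd {X : Type*} {p q m : ℕ} (h : p + (q + 1) = m + 1)
    (h' : p + q = m) (i : Fin (q + 1)) (x : X) (v : Fin m → X) :
    (fun k => ((Fin.cast h (Fin.natAdd p i)).insertNth x v : _ → X)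
      (Fin.cast h (Fin.castAdd (q + 1) k))) =
    (fun k => v (Fin.cast h' (Fin.castAdd q k))) := by
  funext k
  have : Fin.cast h (Fin.castAdd (q + 1) k) =
      (Fin.cast h (Fin.natAdd p i)).succAbove (Fin.cast h' (Fin.castAdd q k)) := by
    ext; simp [Fin.succAbove, Fin.lt_def]; rw [if_pos (by omega)]; simp
  rw [this]; simp

theorem insertNth_natAdd_comp_natAdd {X : Type*} {p q m : ℕ} (h : p + (q + 1) = m + 1)
    (h' : p + q = m) (i : Fin (q + 1)) (x : X) (v : Fin m → X) :
    (fun k => ((Fin.cast h (Fin.natAdd p i)).insertNth x v : _ → X)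
      (Fin.cast h (Fin.natAdd p k))) =
    i.insertNth x (fun k => v (Fin.cast h' (Fin.natAdd p k))) := by
  funext k
  induction k using i.succAboveCases with
  | x => simp
  | p k =>
    have : Fin.cast h (Fin.natAdd p (i.succAbove k)) =
        (Fin.cast h (Fin.natAdd p i)).succAbove (Fin.cast h' (Fin.natAdd p k)) := by
      ext; simp [Fin.succAbove, Fin.lt_def]; split <;> simp; omega
    rw [this]; simp

theorem neg_one_pow_mul_self_mul (k : ℕ) (a : ℝ) : (-1) ^ k * ((-1) ^ k * a) = a := by
  rw [← mul_assoc, ← mul_pow]; simp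

/-- Summing over the places of the left factor at which `x` can be inserted contracts that factor. -/
theorem sum_castAdd {p q m : ℕ} (h : p + 1 + q = m + 1) (h' : p + q = m)
    (α : V [⋀^Fin (p + 1)]→ₗ[ℝ] ℝ) (β : V [⋀^Fin q]→ₗ[ℝ] ℝ) (x : V) (v : Fin m → V) :
    ∑ i : Fin (p + 1), (-1) ^ (i : ℕ) *
      (α (fun k => ((Fin.cast h (Fin.castAdd q i)).insertNth x v : _ → V)
          (Fin.cast h (Fin.castAdd q k))) *
        β (fun k => ((Fin.cast h (Fin.castAdd q i)).insertNth x v : _ → V)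
          (Fin.cast h (Fin.natAdd (p + 1) k)))) =
    (p + 1 : ℝ) * (α.curryLeft x (fun k => v (Fin.cast h' (Fin.castAdd q k))) *
      β (fun k => v (Fin.cast h' (Fin.natAdd p k)))) := by
  rw [Finset.sum_congr rfl (g := fun _ =>
      α.curryLeft x (fun k => v (Fin.cast h' (Fin.castAdd q k))) *
        β (fun k => v (Fin.cast h' (Fin.natAdd p k)))) fun i _ => ?_]
  · simp
  · rw [insertNth_castAdd_comp_castAdd h h', insertNth_castAdd_comp_natAdd h h',
      AlternatingMap.map_insertNth, zsmul_eq_mul, mul_assoc]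
    push_cast
    rw [neg_one_pow_mul_self_mul]
    rfl

/-- Summing over the places of the right factor at which `x` can be inserted contracts that factor. -/
theorem sum_natAdd {p q m : ℕ} (h : p + (q + 1) = m + 1) (h' : p + q = m)
    (α : V [⋀^Fin p]→ₗ[ℝ] ℝ) (β : V [⋀^Fin (q + 1)]→ₗ[ℝ] ℝ) (x : V) (v : Fin m → V) :
    ∑ i : Fin (q + 1), (-1) ^ (p + i : ℕ) *
      (α (fun k => ((Fin.cast h (Fin.natAdd p i)).insertNth x v : _ → V)
          (Fin.cast h (Fin.castAdd (q + 1) k))) *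
        β (fun k => ((Fin.cast h (Fin.natAdd p i)).insertNth x v : _ → V)
          (Fin.cast h (Fin.natAdd p k)))) =
    (-1) ^ p * (q + 1 : ℝ) * (α (fun k => v (Fin.cast h' (Fin.castAdd q k))) *
      β.curryLeft x (fun k => v (Fin.cast h' (Fin.natAdd p k)))) := by
  rw [Finset.sum_congr rfl (g := fun _ =>
      (-1) ^ p * (α (fun k => v (Fin.cast h' (Fin.castAdd q k))) *
        β.curryLeft x (fun k => v (Fin.cast h' (Fin.natAdd p k))))) fun i _ => ?_]
  · simp; ring
  · rw [insertNth_natAdd_comp_castAdd h h', insertNth_natAdd_comp_natAdd h h',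
      AlternatingMap.map_insertNth, zsmul_eq_mul, mul_left_comm (α _), pow_add, mul_assoc]
    push_cast
    rw [neg_one_pow_mul_self_mul]
    rfl

end ShuffleSum

/-- A function of `p` vectors, as a cochain supported on lists of length `p`. -/
def Cochain.ofFun {V : Type*} (p : ℕ) (F : (Fin p → V) → ℝ) : Cochain V := fun l =>
  if h : l.length = p then F (fun i => l.get (i.cast h.symm)) else 0

namespace Cochain

variable {V : Type*}

@[simp] theorem ofFun_ofFn {p : ℕ} (F : (Fin p → V) → ℝ) (v : Fin p → V) :
    ofFun p F (List.ofFn v) = F v := by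
  rw [ofFun, dif_pos List.length_ofFn]
  congr 1
  funext i
  simp

theorem ofFun_of_ne {p : ℕ} (F : (Fin p → V) → ℝ) {l : List V} (h : l.length ≠ p) :
    ofFun p F l = 0 := dif_neg h

theorem ofFun_injective {p : ℕ} {F G : (Fin p → V) → ℝ} (h : ofFun p F = ofFun p G) : F = G := by
  funext v
  rw [← ofFun_ofFn F, h, ofFun_ofFn]

/-- Equality with the cochain of a function of `p` vectors is checked on `p`-tuples, off which
both sides have to vanish. -/
theorem eq_ofFun {p : ℕ} {F : (Fin p → V) → ℝ} {f : Cochain V} (h : ∀ v, f (List.ofFn v) = F v)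
    (h0 : ∀ l, l.length ≠ p → f l = 0) : f = ofFun p F := by
  ext l
  by_cases hl : l.length = p
  · subst hl
    have h1 := h l.get
    have h2 := ofFun_ofFn F l.get
    rw [List.ofFn_get] at h1 h2
    exact h1.trans h2.symm
  · rw [h0 l hl, ofFun_of_ne F hl]

theorem contr_ofFun_succ {p : ℕ} (F : (Fin (p + 1) → V) → ℝ) (v : V) :
    contr v (ofFun (p + 1) F) = ofFun p (fun w => F (Fin.cons v w)) :=
  eq_ofFun (fun w => by rw [contr_apply, ← List.ofFn_cons, ofFun_ofFn])
    fun l hl => ofFun_of_ne _ (by simpa using hl)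

theorem contr_ofFun_zero (F : (Fin 0 → V) → ℝ) (v : V) : contr v (ofFun 0 F) = 0 := by
  ext l; exact ofFun_of_ne F (l := v :: l) (by simp)

theorem ofFun_add {p : ℕ} (F G : (Fin p → V) → ℝ) :
    ofFun p (fun v => F v + G v) = ofFun p F + ofFun p G := by
  ext l
  by_cases hl : l.length = p <;> simp [ofFun, hl]

theorem ofFun_zero (p : ℕ) : ofFun p (fun _ : Fin p → V => 0) = 0 := by
  ext l; simp [ofFun]

theorem ofFun_const_mul {p : ℕ} (c : ℝ) (F : (Fin p → V) → ℝ) :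
    ofFun p (fun v => c * F v) = c • ofFun p F := by
  ext l
  by_cases hl : l.length = p <;> simp [ofFun, hl]

theorem sgn_ofFun {p : ℕ} (F : (Fin p → V) → ℝ) : sgn (ofFun p F) = (-1 : ℝ) ^ p • ofFun p F := by
  ext l
  by_cases hl : l.length = p
  · simp [hl]
  · simp [ofFun_of_ne F hl]

variable [AddCommGroup V] [Module ℝ V]

/-- The normalized antisymmetrization of `α ⊗ β` is the product of cochains. -/
theorem ofFun_altSum (l : List V) {p q m : ℕ} (h : p + q = m) (α : V [⋀^Fin p]→ₗ[ℝ] ℝ)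
    (β : V [⋀^Fin q]→ₗ[ℝ] ℝ) :
    ofFun m (fun v => ((p ! : ℝ) * (q ! : ℝ))⁻¹ * altSum h α β v) l =
      (ofFun p α * ofFun q β) l := by
  induction l generalizing p q m with
  | nil =>
    rcases p with - | p
    · rcases q with - | q
      · subst h
        simp [ofFun, altSum]
      · rw [ofFun_of_ne _ (by simp; omega), mul_nil, ofFun_of_ne β (by simp), mul_zero]
    · rw [ofFun_of_ne _ (by simp; omega), mul_nil, ofFun_of_ne α (by simp), zero_mul]
  | cons x l ih =>
    rw [mul_cons]
    refine (contr_apply x _ l).symm.trans ?_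
    rcases m with - | m
    · obtain rfl : p = 0 := by omega
      obtain rfl : q = 0 := by omega
      rw [contr_ofFun_zero, contr_ofFun_zero, contr_ofFun_zero]
      simp
    rw [contr_ofFun_succ, sgn_ofFun, smul_mul_assoc, smul_apply]
    have hT : ∀ v : Fin m → V, altSum h α β (Fin.cons x v) = _ := sum_perm_succ_add h (fun w =>
      α (fun i => w (Fin.cast h (Fin.castAdd q i))) *
        β (fun j => w (Fin.cast h (Fin.natAdd p j)))) x
    simp_rw [hT, mul_add, Finset.sum_add_distrib, mul_add]
    rw [ofFun_add, add_apply]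
    congr 1
    · rcases p with - | p
      · simp [contr_ofFun_zero, ofFun_zero]
      · have h' : p + q = m := by omega
        rw [contr_ofFun_succ]
        refine Eq.trans ?_ (ih h' (α.curryLeft x) β)
        refine congrArg (fun F => ofFun m F l) (funext fun v => ?_)
        simp_rw [sum_castAdd h h']
        rw [altSum, Finset.mul_sum, Finset.mul_sum]
        refine Finset.sum_congr rfl fun e _ => ?_
        rw [Nat.factorial_succ]
        push_cast
        simp only [Function.comp_apply]
        field_simp
    · rcases q with - | q
      · simp [contr_ofFun_zero, ofFun_zero]
      · have h' : p + q = m := by omega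
        rw [contr_ofFun_succ]
        refine Eq.trans ?_ (congrArg ((-1) ^ p * ·) (ih h' α (β.curryLeft x)))
        rw [← smul_apply, ← ofFun_const_mul]
        refine congrArg (fun F => ofFun m F l) (funext fun v => ?_)
        simp_rw [sum_natAdd h h']
        rw [altSum, Finset.mul_sum, Finset.mul_sum, Finset.mul_sum]
        refine Finset.sum_congr rfl fun e _ => ?_
        rw [Nat.factorial_succ]
        push_cast
        simp only [Function.comp_apply]
        field_simp

end Cochain

/-- Pullback of cochains. -/
def Cochain.comap {V W : Type*} (A : V → W) (f : Cochain W) : Cochain V := fun l => f (l.map A)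

theorem Cochain.comap_mul {V W : Type*} (A : V → W) (f g : Cochain W) :
    Cochain.comap A (f * g) = Cochain.comap A f * Cochain.comap A g := by
  ext l
  induction l generalizing f g with
  | nil => rfl
  | cons v l ih =>
    have h : Cochain.sgn (Cochain.comap A f) = Cochain.comap A (Cochain.sgn f) := by
      ext l; simp [Cochain.comap]
    rw [mul_cons, h]
    exact congrArg₂ (· + ·) (ih (contr (A v) f) g) (ih (Cochain.sgn f) (contr (A v) g))

section ToCochain

variable {V W : Type*} [AddCommGroup V] [Module ℝ V] [TopologicalSpace V]
  [AddCommGroup W] [Module ℝ W] [TopologicalSpace W] {p q : ℕ}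

/-- The cochain of an alternating `p`-form. -/
def toCochain (α : V [⋀^Fin p]→L[ℝ] ℝ) : Cochain V := Cochain.ofFun p α

@[simp] theorem toCochain_ofFn (α : V [⋀^Fin p]→L[ℝ] ℝ) (v : Fin p → V) :
    toCochain α (List.ofFn v) = α v := Cochain.ofFun_ofFn _ v

theorem toCochain_of_ne (α : V [⋀^Fin p]→L[ℝ] ℝ) {l : List V} (h : l.length ≠ p) :
    toCochain α l = 0 := Cochain.ofFun_of_ne _ h

theorem toCochain_injective {α β : V [⋀^Fin p]→L[ℝ] ℝ} (h : toCochain α = toCochain β) : α = β :=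
  DFunLike.coe_injective (Cochain.ofFun_injective h)

theorem sgn_toCochain (α : V [⋀^Fin p]→L[ℝ] ℝ) :
    Cochain.sgn (toCochain α) = (-1 : ℝ) ^ p • toCochain α := Cochain.sgn_ofFun _

theorem toCochain_smul (c : ℝ) (α : V [⋀^Fin p]→L[ℝ] ℝ) : toCochain (c • α) = c • toCochain α :=
  Cochain.ofFun_const_mul c _

theorem toCochain_zero : toCochain (0 : V [⋀^Fin p]→L[ℝ] ℝ) = 0 := Cochain.ofFun_zero p

theorem toCochain_reindex (h : p = q) (α : V [⋀^Fin p]→L[ℝ] ℝ) :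
    toCochain (reindex h α) = toCochain α := by
  subst h; rfl

/-- The wedge product of forms is the product of cochains. -/
theorem toCochain_wedge (α : V [⋀^Fin p]→L[ℝ] ℝ) (β : V [⋀^Fin q]→L[ℝ] ℝ) :
    toCochain (wedge α β) = toCochain α * toCochain β := by
  ext l
  refine Eq.trans ?_ (Cochain.ofFun_altSum l rfl α.toAlternatingMap β.toAlternatingMap)
  exact congrArg (fun F => Cochain.ofFun (p + q) F l) (funext fun v => wedge_apply α β v)

theorem toCochain_compContinuousLinearMap (α : W [⋀^Fin p]→L[ℝ] ℝ) (A : V →L[ℝ] W) :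
    toCochain (α.compContinuousLinearMap A) = Cochain.comap A (toCochain α) := by
  refine (Cochain.eq_ofFun (fun v => ?_) fun l hl => ?_).symm
  · rw [Cochain.comap, List.map_ofFn]
    exact toCochain_ofFn α _
  · exact toCochain_of_ne _ (by simpa using hl)

end ToCochain

section Analysis

variable {E : Type*} [NormedAddCommGroup E] [NormedSpace ℝ E] {p q : ℕ}

theorem cdiffAt_toCochain {Ω : E → E [⋀^Fin p]→L[ℝ] ℝ} {y : E} (h : DifferentiableAt ℝ Ω y) :
    Cochain.CDiffAt (fun z => toCochain (Ω z)) y := by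
  intro l
  by_cases hl : l.length = p
  · simp only [toCochain, Cochain.ofFun, dif_pos hl]
    exact (ContinuousAlternatingMap.apply ℝ E ℝ _).differentiableAt.comp y h
  · simp only [toCochain_of_ne _ hl]
    exact differentiableAt_const _

/-- The exterior derivative of forms is the exterior derivative of cochains: the first term of the
alternating sum is the derivative along the first vector, and the other terms form the exterior
derivative of the contracted form. -/
theorem toCochain_extDeriv {Ω : E → E [⋀^Fin p]→L[ℝ] ℝ} {y : E} (h : DifferentiableAt ℝ Ω y) :
    toCochain (extDeriv Ω y) = Cochain.extD (fun z => toCochain (Ω z)) y := by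
  ext l
  induction l generalizing p with
  | nil => exact toCochain_of_ne _ (by simp)
  | cons v l ih =>
    have key : toCochain (extDeriv Ω y) (v :: l) = fderiv ℝ (fun z => toCochain (Ω z) l) y v -
        Cochain.extD (fun z => Cochain.contr v (toCochain (Ω z))) y l := by
      rcases p with - | p
      · have h0 : ∀ z, Cochain.contr v (toCochain (Ω z)) = 0 := fun z =>
          Cochain.contr_ofFun_zero _ v
        simp only [h0, Cochain.extD_const, Cochain.zero_apply, sub_zero]
        by_cases hl : l.length = 0
        · obtain rfl : l = [] := List.length_eq_zero_iff.1 hl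
          have h1 := toCochain_ofFn (extDeriv Ω y) ![v]
          have h2 : ∀ z, toCochain (Ω z) [] = Ω z ![] := fun z => toCochain_ofFn (Ω z) ![]
          simp only [h2]
          refine h1.trans ?_
          rw [extDeriv_apply h]
          simp [Subsingleton.elim (Fin.removeNth 0 ![v]) ![]]
        · simp [toCochain_of_ne _ hl,
            toCochain_of_ne (extDeriv Ω y) (l := v :: l) (by simpa using hl)]
      · let C : (E [⋀^Fin (p + 1)]→L[ℝ] ℝ) →L[ℝ] E [⋀^Fin p]→L[ℝ] ℝ :=
          (ContinuousLinearMap.apply ℝ _ v).comp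
            (ContinuousAlternatingMap.curryLeftLI (𝕜 := ℝ) (E := E) (F := ℝ)
              (n := p)).toContinuousLinearMap
        have hC : DifferentiableAt ℝ (fun z => C (Ω z)) y := C.differentiableAt.comp y h
        have h0 : ∀ z, Cochain.contr v (toCochain (Ω z)) = toCochain (C (Ω z)) := fun z =>
          Cochain.contr_ofFun_succ _ v
        simp only [h0]
        rw [← ih hC]
        by_cases hl : l.length = p + 1
        · obtain ⟨w, rfl⟩ : ∃ w : Fin (p + 1) → E, l = List.ofFn w := by
            rw [← hl]; exact ⟨l.get, (List.ofFn_get l).symm⟩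
          simp only [toCochain_ofFn]
          rw [← List.ofFn_cons, toCochain_ofFn, extDeriv_apply h, extDeriv_apply hC,
            Fin.sum_univ_succ, sub_eq_add_neg, ← Finset.sum_neg_distrib]
          congr 1
          · simp
          · refine Finset.sum_congr rfl fun i _ => ?_
            have h1 : ∀ z, Ω z (i.succ.removeNth (Fin.cons v w : Fin (p + 2) → E)) =
                C (Ω z) (i.removeNth w) := fun z => by
              refine congrArg (Ω z) (funext fun k => ?_)
              induction k using Fin.cases with
              | zero => simp [Fin.removeNth]
              | succ k => simp [Fin.removeNth]
            simp only [h1]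
            simp [pow_succ]
        · simp [toCochain_of_ne _ hl,
            toCochain_of_ne (extDeriv Ω y) (l := v :: l) (by simpa using hl)]
    exact key

/-- In finite dimension an alternating form is a continuous linear function of finitely many of its
values, so that regularity of forms may be tested on values. -/
theorem exists_reconstruction (E : Type*) [NormedAddCommGroup E] [NormedSpace ℝ E]
    [FiniteDimensional ℝ E] (p : ℕ) :
    ∃ (ι : Type) (_ : Fintype ι) (v : ι → Fin p → E)
      (G : (ι → ℝ) →L[ℝ] E [⋀^Fin p]→L[ℝ] ℝ), ∀ α, G (fun i => α (v i)) = α := by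
  let b := Module.finBasis ℝ E
  let ev : (E [⋀^Fin p]→L[ℝ] ℝ) →ₗ[ℝ] ((Fin p → Fin (Module.finrank ℝ E)) → ℝ) :=
    LinearMap.pi fun s => (ContinuousAlternatingMap.apply ℝ E ℝ fun i => b (s i)).toLinearMap
  have hev : LinearMap.ker ev = ⊥ := by
    refine LinearMap.ker_eq_bot'.2 fun α hα => ?_
    refine ContinuousAlternatingMap.toAlternatingMap_injective
      (Module.Basis.ext_alternating b fun s _ => ?_)
    exact congrFun hα s
  obtain ⟨G, hG⟩ := LinearMap.exists_leftInverse_of_injective ev hev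
  exact ⟨Fin p → Fin (Module.finrank ℝ E), inferInstance, fun s i => b (s i),
    LinearMap.toContinuousLinearMap G,
    fun α => (LinearMap.congr_fun hG α :)⟩

variable [FiniteDimensional ℝ E]

theorem differentiableAt_of_cdiffAt {Ω : E → E [⋀^Fin p]→L[ℝ] ℝ} {y : E}
    (h : Cochain.CDiffAt (fun z => toCochain (Ω z)) y) : DifferentiableAt ℝ Ω y := by
  obtain ⟨ι, _, v, G, hG⟩ := exists_reconstruction E p
  have : Ω = fun z => G (fun i => Ω z (v i)) := by simp only [hG]
  rw [this]
  refine G.differentiableAt.comp y (differentiableAt_pi.2 fun i => ?_)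
  simpa using h (List.ofFn (v i))

theorem contDiffAt_of_apply {F : Type*} [NormedAddCommGroup F] [NormedSpace ℝ F]
    {Ω : F → E [⋀^Fin p]→L[ℝ] ℝ} {y : F} {k : WithTop ℕ∞}
    (h : ∀ v, ContDiffAt ℝ k (fun z => Ω z v) y) : ContDiffAt ℝ k Ω y := by
  obtain ⟨ι, _, v, G, hG⟩ := exists_reconstruction E p
  have : Ω = fun z => G (fun i => Ω z (v i)) := by simp only [hG]
  rw [this]
  exact G.contDiff.contDiffAt.comp y (contDiffAt_pi.2 fun i => h (v i))

end Analysis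

/-! ### Coordinate changes and naturality of the exterior derivative -/

section Charts

variable {n : ℕ} {M : Type*} [TopologicalSpace M] [ChartedSpace (Cn n) M]

/-- The coordinate change from the preferred chart at `x` to the preferred chart at `x'`. -/
def coordChange (x x' : M) : Cn n → Cn n := chartAt (Cn n) x' ∘ (chartAt (Cn n) x).symm

variable {x x' x'' : M} {y : Cn n}

theorem eventually_mem_source (hy : y ∈ (chartAt (Cn n) x).target)
    (hy' : (chartAt (Cn n) x).symm y ∈ (chartAt (Cn n) x').source) :
    ∀ᶠ z in nhds y, z ∈ (chartAt (Cn n) x).target ∧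
      (chartAt (Cn n) x).symm z ∈ (chartAt (Cn n) x').source :=
  Filter.Eventually.and ((chartAt (Cn n) x).open_target.mem_nhds hy)
    (((chartAt (Cn n) x).continuousAt_symm hy).eventually_mem
      ((chartAt (Cn n) x').open_source.mem_nhds hy'))

theorem coordChange_coordChange (hy : y ∈ (chartAt (Cn n) x).target)
    (hy' : (chartAt (Cn n) x).symm y ∈ (chartAt (Cn n) x').source) :
    coordChange x x'' =ᶠ[nhds y] coordChange x' x'' ∘ coordChange x x' := by
  filter_upwards [eventually_mem_source hy hy'] with z hz
  simp [coordChange, (chartAt (Cn n) x').left_inv hz.2]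

variable [IsManifold 𝓘(ℂ, Cn n) ω M]

theorem contDiffAt_complex_coordChange (hy : y ∈ (chartAt (Cn n) x).target)
    (hy' : (chartAt (Cn n) x).symm y ∈ (chartAt (Cn n) x').source) :
    ContDiffAt ℂ ω (coordChange x x') y := by
  have h := contDiffWithinAt_ext_coord_change (I := 𝓘(ℂ, Cn n)) (n := ω) x' x (y := y)
    (by simp [hy, hy'])
  simpa [contDiffWithinAt_univ, coordChange] using h

theorem contDiffAt_coordChange (hy : y ∈ (chartAt (Cn n) x).target)
    (hy' : (chartAt (Cn n) x).symm y ∈ (chartAt (Cn n) x').source) :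
    ContDiffAt ℝ ω (coordChange x x') y :=
  (contDiffAt_complex_coordChange hy hy').restrict_scalars ℝ

theorem differentiableAt_coordChange (hy : y ∈ (chartAt (Cn n) x).target)
    (hy' : (chartAt (Cn n) x).symm y ∈ (chartAt (Cn n) x').source) :
    DifferentiableAt ℝ (coordChange x x') y :=
  (contDiffAt_coordChange hy hy').differentiableAt (by simp)

/-- Coordinate changes are holomorphic, so that their real derivatives commute with `i`. -/
theorem fderiv_coordChange_mulI (hy : y ∈ (chartAt (Cn n) x).target)
    (hy' : (chartAt (Cn n) x).symm y ∈ (chartAt (Cn n) x').source) (v : Cn n) :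
    fderiv ℝ (coordChange x x') y (mulI n v) = mulI n (fderiv ℝ (coordChange x x') y v) := by
  have h := (contDiffAt_complex_coordChange hy hy').differentiableAt (by simp)
  rw [h.fderiv_restrictScalars ℝ]
  simp [mulI]

/-- Tangent spaces are identified with the model through the preferred charts, so that the derivative
of an inverse chart is the derivative of a coordinate change. -/
theorem mfderiv_chart_symm (hy : y ∈ (chartAt (Cn n) x).target) :
    (mfderiv 𝓘(ℝ, Cn n) 𝓘(ℝ, Cn n) (chartAt (Cn n) x).symm y : Cn n →L[ℝ] Cn n) =
      fderiv ℝ (coordChange x ((chartAt (Cn n) x).symm y)) y := by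
  have h : MDifferentiableAt 𝓘(ℝ, Cn n) 𝓘(ℝ, Cn n) (chartAt (Cn n) x).symm y :=
    mdifferentiableAt_atlas_symm (chart_mem_atlas _ _) hy
  rw [h.mfderiv]
  simp [coordChange, Function.comp_def]
  rfl

theorem mfderiv_chart_self (x : M) :
    (mfderiv 𝓘(ℝ, Cn n) 𝓘(ℝ, Cn n) (chartAt (Cn n) x) x : Cn n →L[ℝ] Cn n) =
      ContinuousLinearMap.id ℝ (Cn n) := mfderiv_extChartAt_self (I := 𝓘(ℝ, Cn n)) (x := x)

/-- The derivative of the inverse chart at `x`, through the chart at `x'`. -/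
theorem mfderiv_chart_symm_eq_comp (hy : y ∈ (chartAt (Cn n) x).target)
    (hy' : (chartAt (Cn n) x).symm y ∈ (chartAt (Cn n) x').source) :
    (mfderiv 𝓘(ℝ, Cn n) 𝓘(ℝ, Cn n) (chartAt (Cn n) x).symm y : Cn n →L[ℝ] Cn n) =
      (mfderiv 𝓘(ℝ, Cn n) 𝓘(ℝ, Cn n) (chartAt (Cn n) x').symm (coordChange x x' y) :
        Cn n →L[ℝ] Cn n).comp (fderiv ℝ (coordChange x x') y) := by
  have h1 : coordChange x x' y ∈ (chartAt (Cn n) x').target := (chartAt (Cn n) x').map_source hy'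
  have h2 : (chartAt (Cn n) x').symm (coordChange x x' y) = (chartAt (Cn n) x).symm y :=
    (chartAt (Cn n) x').left_inv hy'
  rw [mfderiv_chart_symm hy, mfderiv_chart_symm h1, h2, (coordChange_coordChange hy hy').fderiv_eq]
  refine fderiv_comp y (differentiableAt_coordChange h1 ?_) (differentiableAt_coordChange hy hy')
  rw [h2]; exact mem_chart_source _ _

theorem mfderiv_chart_symm_mulI (hy : y ∈ (chartAt (Cn n) x).target) (v : Cn n) :
    (mfderiv 𝓘(ℝ, Cn n) 𝓘(ℝ, Cn n) (chartAt (Cn n) x).symm y : Cn n →L[ℝ] Cn n) (mulI n v) =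
      mulI n ((mfderiv 𝓘(ℝ, Cn n) 𝓘(ℝ, Cn n) (chartAt (Cn n) x).symm y :
        Cn n →L[ℝ] Cn n) v) := by
  rw [mfderiv_chart_symm hy]
  exact fderiv_coordChange_mulI hy (mem_chart_source _ _) v

end Charts

section Forms

variable {n : ℕ} {M : Type*} [TopologicalSpace M] [ChartedSpace (Cn n) M]
  [IsManifold 𝓘(ℂ, Cn n) ω M] {p q : ℕ}

/-- Coordinate expressions in two charts are related by pullback along the coordinate change. -/
theorem Form.inChart_eventuallyEq (α : Form n M p) {x x' : M} {y : Cn n}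
    (hy : y ∈ (chartAt (Cn n) x).target)
    (hy' : (chartAt (Cn n) x).symm y ∈ (chartAt (Cn n) x').source) :
    α.inChart x =ᶠ[nhds y] fun z =>
      (α.inChart x' (coordChange x x' z)).compContinuousLinearMap
        (fderiv ℝ (coordChange x x') z) := by
  filter_upwards [eventually_mem_source hy hy'] with z hz
  have h2 : (chartAt (Cn n) x').symm (coordChange x x' z) = (chartAt (Cn n) x).symm z :=
    (chartAt (Cn n) x').left_inv hz.2
  ext v
  have h3 : ∀ u, (mfderiv 𝓘(ℝ, Cn n) 𝓘(ℝ, Cn n) (chartAt (Cn n) x).symm z :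
      Cn n →L[ℝ] Cn n) u = _ := fun u => DFunLike.congr_fun (mfderiv_chart_symm_eq_comp hz.1 hz.2) u
  have h4 : ∀ (a b : M) (_ : a = b) (w : Fin p → Cn n), α a w = α b w := by
    rintro a _ rfl w; rfl
  refine Eq.trans ?_ (h4 _ _ h2 _).symm
  exact congrArg (α ((chartAt (Cn n) x).symm z)) (funext fun i => h3 (v i))

/-- The coordinate expressions of the form are differentiable on the domains of the charts. -/
def Form.Diff (α : Form n M p) : Prop :=
  ∀ x : M, ∀ y ∈ (chartAt (Cn n) x).target, DifferentiableAt ℝ (α.inChart x) y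

/-- The exterior derivative in any chart is the exterior derivative of the coordinate
expression. -/
theorem Form.inChart_d {α : Form n M p} (hα : α.Diff) {x : M} {y : Cn n}
    (hy : y ∈ (chartAt (Cn n) x).target) : α.d.inChart x y = extDeriv (α.inChart x) y := by
  have hs : (chartAt (Cn n) x).symm y ∈ (chartAt (Cn n) ((chartAt (Cn n) x).symm y)).source :=
    mem_chart_source _ _
  have hd : DifferentiableAt ℝ (α.inChart ((chartAt (Cn n) x).symm y))
      (coordChange x ((chartAt (Cn n) x).symm y) y) :=
    hα _ _ ((chartAt (Cn n) _).map_source hs)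
  rw [(α.inChart_eventuallyEq hy hs).extDeriv_eq,
    extDeriv_pullback hd (contDiffAt_coordChange hy hs) (by simp)]
  ext v
  refine congrArg (extDeriv (α.inChart ((chartAt (Cn n) x).symm y)) _) (funext fun i => ?_)
  change (mfderiv 𝓘(ℝ, Cn n) 𝓘(ℝ, Cn n) (chartAt (Cn n) _) _ : Cn n →L[ℝ] Cn n)
    ((mfderiv 𝓘(ℝ, Cn n) 𝓘(ℝ, Cn n) (chartAt (Cn n) x).symm y : Cn n →L[ℝ] Cn n) (v i)) = _
  rw [mfderiv_chart_self, mfderiv_chart_symm hy]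
  rfl

end Forms

/-! ### Differential forms as cochains -/

namespace Cochain

variable {n : ℕ}

theorem comap_one {V W : Type*} (A : V → W) : comap A (1 : Cochain W) = 1 := by
  ext l
  cases l with
  | nil => rfl
  | cons v l => exact (one_cons _ _).trans (one_cons _ _).symm

theorem comap_smul {V W : Type*} (A : V → W) (c : ℝ) (f : Cochain W) :
    comap A (c • f) = c • comap A f := rfl

theorem sgn_comap {V W : Type*} (A : V → W) (f : Cochain W) :
    sgn (comap A f) = comap A (sgn f) := by
  ext l; simp [comap]

/-- The action of the complex structure of `ℂⁿ` on cochains. -/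
def J (f : Cochain (Cn n)) : Cochain (Cn n) := sgn (comap (mulI n) f)

theorem J_mul (f g : Cochain (Cn n)) : J (f * g) = J f * J g := by
  rw [J, comap_mul, sgn_mul]; rfl

theorem J_smul (c : ℝ) (f : Cochain (Cn n)) : J (c • f) = c • J f :=
  map_smul sgn c (comap (mulI n) f)

theorem J_one : J (1 : Cochain (Cn n)) = 1 := by
  rw [J, comap_one, sgn_one]

theorem J_pow (f : Cochain (Cn n)) (k : ℕ) : J (f ^ k) = J f ^ k := by
  induction k with
  | zero => simp [J_one]
  | succ k ih => rw [pow_succ, pow_succ, J_mul, ih]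

theorem comap_id {V : Type*} (f : Cochain V) : comap (fun v => v) f = f := by
  ext l; simp [comap]

end Cochain

section Forms

variable {n : ℕ} {M : Type*} [TopologicalSpace M] [ChartedSpace (Cn n) M] {p q r : ℕ}

/-- The cochain of a differential form at a point. -/
def Form.co (α : Form n M p) (x : M) : Cochain (Cn n) :=
  toCochain (V := Cn n) (α x)

theorem Form.ext_co {α β : Form n M p} (h : ∀ x, α.co x = β.co x) : α = β :=
  funext fun x => toCochain_injective (V := Cn n) (h x)

theorem Form.sgn_co (α : Form n M p) (x : M) :
    Cochain.sgn (α.co x) = (-1 : ℝ) ^ p • α.co x := sgn_toCochain (V := Cn n) (α x)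

theorem Form.co_wedge (α : Form n M p) (β : Form n M q) (x : M) :
    (α.wedge β).co x = α.co x * β.co x := toCochain_wedge (V := Cn n) (α x) (β x)

theorem Form.co_cast (h : p = q) (α : Form n M p) (x : M) : (α.cast h).co x = α.co x :=
  toCochain_reindex (V := Cn n) h (α x)

theorem Form.co_smul (c : ℝ) (α : Form n M p) (x : M) : (c • α).co x = c • α.co x :=
  toCochain_smul (V := Cn n) c (α x)

theorem Form.co_zero (x : M) : (0 : Form n M p).co x = 0 := toCochain_zero (V := Cn n)

theorem Form.co_pow (α : Form n M 2) (k : ℕ) (x : M) : (α.pow k).co x = α.co x ^ k := by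
  induction k with
  | zero =>
    ext l
    cases l with
    | nil => rfl
    | cons v l =>
      rw [pow_zero, Cochain.one_cons]
      exact toCochain_of_ne (V := Cn n) _ (by simp)
  | succ k ih => rw [pow_succ, ← ih]; exact Form.co_wedge _ _ x

theorem Form.co_J (α : Form n M p) (x : M) : α.J.co x = Cochain.J (α.co x) := by
  have h : Cochain.sgn (toCochain ((show Cn n [⋀^Fin p]→L[ℝ] ℝ from α x).compContinuousLinearMap
    (mulI n))) = Cochain.J (α.co x) := by
    rw [toCochain_compContinuousLinearMap]; rfl
  rw [← h, sgn_toCochain, ← toCochain_smul]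
  rfl

theorem Form.co_Jinv (α : Form n M p) (x : M) :
    α.Jinv.co x = (-1 : ℝ) ^ p • Cochain.J (α.co x) := by
  rw [← Form.co_J, ← Form.co_smul]; rfl

theorem Form.co_neg (α : Form n M p) (x : M) : Form.co (fun x => -(α x)) x = -α.co x := by
  have h := Form.co_smul (-1) α x
  rw [neg_one_smul] at h
  exact (congrArg (fun β : Form n M p => β.co x) (neg_one_smul ℝ α).symm).trans h

/-- The derivative at `y` of the inverse of the preferred chart at `x`, in coordinates on both
sides. -/
def chartDeriv (x : M) (y : Cn n) : Cn n →L[ℝ] Cn n :=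
  mfderiv 𝓘(ℝ, Cn n) 𝓘(ℝ, Cn n) (chartAt (Cn n) x).symm y

/-- The coordinate expression of a form, as a cochain. -/
theorem Form.toCochain_inChart (α : Form n M p) (x : M) (y : Cn n) :
    toCochain (α.inChart x y) = Cochain.comap (chartDeriv x y)
      (α.co ((chartAt (Cn n) x).symm y)) :=
  toCochain_compContinuousLinearMap (V := Cn n) (W := Cn n) _ _

theorem Form.toCochain_inChart_of_co_eq {α : Form n M p} {β : Form n M q} {γ : Form n M r} {c : ℝ}
    (h : ∀ x, α.co x = c • (β.co x * γ.co x)) (x : M) (y : Cn n) :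
    toCochain (α.inChart x y) =
      c • (toCochain (β.inChart x y) * toCochain (γ.inChart x y)) := by
  rw [Form.toCochain_inChart, Form.toCochain_inChart, Form.toCochain_inChart, h,
    Cochain.comap_smul, Cochain.comap_mul]

/-- Stated for any form with the values of a multiple of `β ∧ γ`, so that degrees need not agree
definitionally. -/
theorem Form.Diff.of_co_eq {α : Form n M p} {β : Form n M q} {γ : Form n M r} {c : ℝ}
    (hβ : β.Diff) (hγ : γ.Diff) (h : ∀ x, α.co x = c • (β.co x * γ.co x)) : α.Diff := by
  intro x y hy
  refine differentiableAt_of_cdiffAt ?_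
  simp only [Form.toCochain_inChart_of_co_eq h]
  exact ((cdiffAt_toCochain (hβ x y hy)).mul (cdiffAt_toCochain (hγ x y hy))).smul c

theorem Form.Diff.pow {α : Form n M 2} (hα : α.Diff) : ∀ k, (α.pow k).Diff
  | 0 => fun x y _ => by
    refine differentiableAt_of_cdiffAt ?_
    have h : ∀ z, toCochain ((α.pow 0).inChart x z) = 1 := fun z => by
      rw [Form.toCochain_inChart, Form.co_pow, pow_zero, Cochain.comap_one]
    simp only [h]
    exact fun l => differentiableAt_const _
  | k + 1 => (hα.pow k).of_co_eq hα (c := 1) fun x => by rw [one_smul]; exact Form.co_wedge _ _ x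

/-- Smoothness of the coordinate expressions of a form. -/
def Form.Smooth (α : Form n M p) : Prop :=
  ∀ x : M, ∀ y ∈ (chartAt (Cn n) x).target, ContDiffAt ℝ ∞ (α.inChart x) y

theorem Form.Smooth.diff {α : Form n M p} (hα : α.Smooth) : α.Diff :=
  fun x y hy => (hα x y hy).differentiableAt (by simp)

variable [IsManifold 𝓘(ℂ, Cn n) ω M]

theorem chartDeriv_self (x : M) :
    chartDeriv x (chartAt (Cn n) x x) = ContinuousLinearMap.id ℝ (Cn n) := by
  rw [chartDeriv, mfderiv_chart_symm (mem_chart_target _ _),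
    (chartAt (Cn n) x).left_inv (mem_chart_source _ _)]
  have h : coordChange x x =ᶠ[nhds (chartAt (Cn n) x x)] id := by
    filter_upwards [(chartAt (Cn n) x).open_target.mem_nhds (mem_chart_target _ _)] with z hz
    exact (chartAt (Cn n) x).right_inv hz
  rw [h.fderiv_eq, fderiv_id]

theorem Form.toCochain_inChart_self (α : Form n M p) (x : M) :
    toCochain (α.inChart x (chartAt (Cn n) x x)) = α.co x := by
  rw [Form.toCochain_inChart, chartDeriv_self,
    (chartAt (Cn n) x).left_inv (mem_chart_source _ _)]
  exact Cochain.comap_id _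

theorem Form.co_d {α : Form n M p} (hα : α.Diff) (x : M) :
    α.d.co x = Cochain.extD (fun z => toCochain (α.inChart x z)) (chartAt (Cn n) x x) := by
  rw [← toCochain_extDeriv (hα x _ (mem_chart_target _ _))]
  refine (toCochain_compContinuousLinearMap (V := Cn n) (W := Cn n) _
    (mfderiv 𝓘(ℝ, Cn n) 𝓘(ℝ, Cn n) (chartAt (Cn n) x) x)).trans ?_
  rw [mfderiv_chart_self]
  exact Cochain.comap_id _

/-- The Leibniz rule for a form of arbitrary type whose values are those of `c • β ∧ γ`. -/
theorem Form.co_d_of_co_eq {α : Form n M p} {β : Form n M q} {γ : Form n M r} {c : ℝ}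
    (hβ : β.Diff) (hγ : γ.Diff) (h : ∀ x, α.co x = c • (β.co x * γ.co x)) (x : M) :
    α.d.co x = c • (β.d.co x * γ.co x + Cochain.sgn (β.co x) * γ.d.co x) := by
  have hm := mem_chart_target (Cn n) x
  rw [Form.co_d (hβ.of_co_eq hγ h)]
  simp only [Form.toCochain_inChart_of_co_eq h]
  rw [Cochain.extD_smul _ _ _ ((cdiffAt_toCochain (hβ x _ hm)).mul (cdiffAt_toCochain (hγ x _ hm))),
    Cochain.extD_mul (cdiffAt_toCochain (hβ x _ hm))
    (cdiffAt_toCochain (hγ x _ hm)), ← Form.co_d hβ, ← Form.co_d hγ, Form.toCochain_inChart_self,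
    Form.toCochain_inChart_self]

theorem Form.Diff.J {α : Form n M p} (hα : α.Diff) : α.J.Diff := by
  intro x y hy
  refine differentiableAt_of_cdiffAt ?_
  have h : (fun z => toCochain (α.J.inChart x z)) =ᶠ[nhds y]
      fun z => Cochain.J (toCochain (α.inChart x z)) := by
    filter_upwards [(chartAt (Cn n) x).open_target.mem_nhds hy] with z hz
    rw [Form.toCochain_inChart, Form.toCochain_inChart, Form.co_J]
    have hA : ∀ A : Cn n → Cn n, (∀ v, A (mulI n v) = mulI n (A v)) → ∀ f : Cochain (Cn n),
        Cochain.comap A (Cochain.J f) = Cochain.J (Cochain.comap A f) := by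
      intro A hA f
      rw [Cochain.J, ← Cochain.sgn_comap, Cochain.J]
      congr 1
      ext l
      simp [Cochain.comap, Function.comp_def, hA]
    exact hA _ (mfderiv_chart_symm_mulI hz) _
  intro l
  have h2 := cdiffAt_toCochain (hα x y hy) (l.map (mulI n))
  refine (h2.const_mul ((-1) ^ l.length)).congr_of_eventuallyEq ?_
  filter_upwards [h] with z hz
  rw [hz]
  simp [Cochain.J, Cochain.comap]

/-- In any chart `dα` is the exterior derivative of the chart expression of `α`. -/
theorem Form.Smooth.diff_d {α : Form n M p} (hα : α.Smooth) : α.d.Diff := by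
  intro x y hy
  have h : α.d.inChart x =ᶠ[nhds y] extDeriv (α.inChart x) := by
    filter_upwards [(chartAt (Cn n) x).open_target.mem_nhds hy] with z hz
    exact Form.inChart_d hα.diff hz
  refine DifferentiableAt.congr_of_eventuallyEq ?_ h
  have h2 : DifferentiableAt ℝ (fderiv ℝ (α.inChart x)) y :=
    ((hα x y hy).fderiv_right (m := 1) (by norm_cast)).differentiableAt (by simp)
  exact (ContinuousAlternatingMap.alternatizeUncurryFinCLM ℝ (Cn n) ℝ).differentiableAt.comp y h2

/-- `d(α^k) = k dα ∧ α^(k-1)` for a `2`-form `α`. -/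
theorem Form.co_d_pow {α : Form n M 2} (hα : α.Diff) (k : ℕ) (x : M) :
    (α.pow k).d.co x = (k : ℝ) • (α.d.co x * α.co x ^ (k - 1)) := by
  have he : Cochain.sgn (α.co x) = α.co x := by rw [Form.sgn_co]; simp
  induction k with
  | zero =>
    have h : ∀ z, toCochain ((α.pow 0).inChart x z) = 1 := fun z => by
      rw [Form.toCochain_inChart, Form.co_pow, pow_zero, Cochain.comap_one]
    rw [Form.co_d (hα.pow 0)]
    simp only [h, Cochain.extD_const]
    simp
  | succ k ih =>
    have h := Form.co_d_of_co_eq (α := α.pow (k + 1)) (c := 1) (hα.pow k) hα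
      (fun x => by rw [one_smul]; exact Form.co_wedge _ _ x) x
    rw [h, ih, Form.co_pow, Cochain.sgn_pow, he, one_smul, smul_mul_assoc,
      ((Cochain.commute_of_even he _).pow_left k).eq, Nat.add_sub_cancel]
    push_cast
    rw [add_smul, one_smul]
    rcases k with - | k
    · simp
    · rw [Nat.add_sub_cancel, mul_assoc, ← pow_succ]

end Forms

/-! ### Smoothness of the fundamental form -/

section Smooth

open Bundle

variable {n : ℕ} {M : Type*} [TopologicalSpace M] [ChartedSpace (Cn n) M]
  [IsManifold 𝓘(ℂ, Cn n) ω M]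

/-- Coordinate vector fields of a chart are smooth. -/
theorem contMDiffAt_chart_symm_vector (x : M) {y : Cn n} (hy : y ∈ (chartAt (Cn n) x).target)
    (v : Cn n) :
    ContMDiffAt 𝓘(ℝ, Cn n) (𝓘(ℝ, Cn n).prod 𝓘(ℝ, Cn n)) ∞
      (fun z => TotalSpace.mk' (Cn n) (E := fun x : M => Tan n x) ((chartAt (Cn n) x).symm z)
        (mfderiv 𝓘(ℝ, Cn n) 𝓘(ℝ, Cn n) (chartAt (Cn n) x).symm z v)) y := by
  have ho := (chartAt (Cn n) x).open_target
  have h1 : ContMDiffOn 𝓘(ℝ, Cn n) 𝓘(ℝ, Cn n) ω (chartAt (Cn n) x).symm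
      (chartAt (Cn n) x).target := contMDiffOn_chart_symm
  have h2 := h1.contMDiffOn_tangentMapWithin (m := ∞) (by simp) ho.uniqueMDiffOn
  have h3 : ContMDiffAt 𝓘(ℝ, Cn n) (𝓘(ℝ, Cn n).prod 𝓘(ℝ, Cn n)) ∞
      (fun z => (⟨z, v⟩ : TangentBundle 𝓘(ℝ, Cn n) (Cn n))) y :=
    contMDiffAt_vectorSpace_iff_contDiffAt.2 contDiffAt_const
  have h4 := (h2 ⟨y, v⟩ hy).comp y (h3.contMDiffWithinAt (s := (chartAt (Cn n) x).target))
    (fun z hz => hz)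
  refine (h4.contMDiffAt (ho.mem_nhds hy)).congr_of_eventuallyEq ?_
  filter_upwards [ho.mem_nhds hy] with z hz
  simp only [Function.comp_apply, tangentMapWithin, mfderivWithin_of_isOpen ho hz]

variable (g : HermitianMetric n M)

theorem HermitianMetric.contDiffAt_inner (x : M) {y : Cn n} (hy : y ∈ (chartAt (Cn n) x).target)
    (v w : Cn n) :
    ContDiffAt ℝ ∞ (fun z => g.inner ((chartAt (Cn n) x).symm z)
      (mfderiv 𝓘(ℝ, Cn n) 𝓘(ℝ, Cn n) (chartAt (Cn n) x).symm z v)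
      (mfderiv 𝓘(ℝ, Cn n) 𝓘(ℝ, Cn n) (chartAt (Cn n) x).symm z w)) y := by
  have h1 : ContMDiffAt 𝓘(ℝ, Cn n) 𝓘(ℝ, Cn n) ∞ (chartAt (Cn n) x).symm y :=
    contMDiffOn_chart_symm.contMDiffAt ((chartAt (Cn n) x).open_target.mem_nhds hy)
  have h2 : ContMDiffAt 𝓘(ℝ, Cn n) (𝓘(ℝ, Cn n).prod 𝓘(ℝ)) ∞
      (fun z => TotalSpace.mk' ℝ (E := Bundle.Trivial M ℝ) ((chartAt (Cn n) x).symm z)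
        (g.inner ((chartAt (Cn n) x).symm z)
      (mfderiv 𝓘(ℝ, Cn n) 𝓘(ℝ, Cn n) (chartAt (Cn n) x).symm z v)
      (mfderiv 𝓘(ℝ, Cn n) 𝓘(ℝ, Cn n) (chartAt (Cn n) x).symm z w))) y := by
    apply ContMDiffAt.clm_bundle_apply₂ (F₁ := Cn n) (F₂ := Cn n)
    · exact ContMDiffAt.comp y g.contMDiff.contMDiffAt h1
    · exact contMDiffAt_chart_symm_vector x hy v
    · exact contMDiffAt_chart_symm_vector x hy w
  simp only [contMDiffAt_totalSpace] at h2
  exact contMDiffAt_iff_contDiffAt.1 h2.2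

theorem HermitianMetric.smooth_fundamentalForm : g.fundamentalForm.Smooth := by
  intro x y hy
  refine contDiffAt_of_apply fun v => ?_
  refine (g.contDiffAt_inner x hy (mulI n (v 0)) (v 1)).congr_of_eventuallyEq ?_
  filter_upwards [(chartAt (Cn n) x).open_target.mem_nhds hy] with z hz
  exact congrArg (fun u => g.inner ((chartAt (Cn n) x).symm z) u
    (mfderiv 𝓘(ℝ, Cn n) 𝓘(ℝ, Cn n) (chartAt (Cn n) x).symm z (v 1)))
    (mfderiv_chart_symm_mulI hz (v 0)).symm

end Smooth

/-! ### Hermitian linear algebra -/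

theorem exists_orthonormal_basis_of_core {V : Type*} [AddCommGroup V] [Module ℂ V]
    [FiniteDimensional ℂ V] (c : InnerProductSpace.Core ℂ V) {n : ℕ}
    (hn : Module.finrank ℂ V = n) :
    ∃ b : Module.Basis (Fin n) ℂ V, ∀ i j, c.inner (b i) (b j) = if i = j then 1 else 0 := by
  let _ : NormedAddCommGroup V := c.toNormedAddCommGroup
  let _ : InnerProductSpace ℂ V := InnerProductSpace.ofCore c.toCore
  let b := (stdOrthonormalBasis ℂ V).reindex (finCongr hn)
  exact ⟨b.toBasis, fun i j => by simpa using orthonormal_iff_ite.1 b.orthonormal i j⟩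

section Hermitian

variable {n : ℕ}

/-- A real inner product on `ℂⁿ` that is invariant under multiplication by `i`. -/
structure IsHermitianForm (B : Cn n →L[ℝ] Cn n →L[ℝ] ℝ) : Prop where
  symm (v w : Cn n) : B v w = B w v
  pos (v : Cn n) (hv : v ≠ 0) : 0 < B v v
  inv (v w : Cn n) : B (mulI n v) (mulI n w) = B v w

variable {B : Cn n →L[ℝ] Cn n →L[ℝ] ℝ} (hB : IsHermitianForm B)
include hB

theorem IsHermitianForm.mulI_left (v w : Cn n) : B (mulI n v) w = -B v (mulI n w) := by
  have h := hB.inv v (mulI n w)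
  rw [mulI_mulI, map_neg] at h
  linarith

theorem IsHermitianForm.mulI_self (v : Cn n) : B (mulI n v) v = 0 := by
  have h := hB.mulI_left v v
  rw [hB.symm v] at h
  linarith

/-- The complex inner product with real part `B`. -/
abbrev IsHermitianForm.core : InnerProductSpace.Core ℂ (Cn n) where
  inner v w := ⟨B v w, B (mulI n v) w⟩
  conj_inner_symm v w := by
    apply Complex.ext
    · simp [hB.symm w v]
    · simp [hB.mulI_left w v, hB.symm w]
  re_inner_nonneg v := by
    by_cases hv : v = 0
    · simp [hv]
    · exact (hB.pos v hv).le
  definite v hv := by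
    by_contra h
    exact (hB.pos v h).ne' (congrArg Complex.re hv)
  add_left u v w := by
    apply Complex.ext <;> simp
  smul_left v w r := by
    have h : r • v = r.re • v + r.im • mulI n v := by
      simp only [mulI, _root_.smul_apply, ContinuousLinearMap.id_apply]
      conv_lhs => rw [← Complex.re_add_im r]
      rw [add_smul, mul_smul, Complex.coe_smul, Complex.coe_smul]
    apply Complex.ext <;> simp [h, mulI_mulI]

/-- Unitary bases exist. -/
theorem IsHermitianForm.exists_unitary_basis :
    ∃ b : Module.Basis (Fin n) ℂ (Cn n),
      (∀ i j, B (b i) (b j) = if i = j then 1 else 0) ∧ ∀ i j, B (mulI n (b i)) (b j) = 0 := by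
  obtain ⟨b, hb⟩ := exists_orthonormal_basis_of_core hB.core (n := n) (by simp)
  refine ⟨b, fun i j => ?_, fun i j => ?_⟩
  · have h := congrArg Complex.re (hb i j)
    exact h.trans (by split <;> simp)
  · have h := congrArg Complex.im (hb i j)
    exact h.trans (by split <;> simp)

/-- The fundamental form as a cochain. -/
def IsHermitianForm.fund : Cochain (Cn n) :=
  toCochain (ofBilin (B.comp (mulI n)) hB.mulI_self)

theorem IsHermitianForm.fund_pair (u v : Cn n) : hB.fund [u, v] = B (mulI n u) v :=
  toCochain_ofFn (ofBilin (B.comp (mulI n)) hB.mulI_self) ![u, v]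

theorem IsHermitianForm.fund_of_ne {l : List (Cn n)} (h : l.length ≠ 2) : hB.fund l = 0 :=
  toCochain_of_ne _ h

theorem IsHermitianForm.sgn_fund : Cochain.sgn hB.fund = hB.fund := by
  rw [IsHermitianForm.fund, sgn_toCochain]; simp

theorem IsHermitianForm.J_fund : Cochain.J hB.fund = hB.fund := by
  have h : Cochain.comap (mulI n) hB.fund = hB.fund := by
    refine Cochain.eq_ofFun (fun v => ?_) fun l hl => hB.fund_of_ne (by simpa using hl)
    have hv : List.ofFn v = [v 0, v 1] := by simp [List.ofFn_succ]
    rw [Cochain.comap, hv]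
    exact (hB.fund_pair _ _).trans (hB.inv _ _)
  rw [Cochain.J, h, hB.sgn_fund]

/-- On a unitary frame `(v₁, i v₁, …, v_m, i v_m)`, the `m`-th power of the fundamental form is
`m!`. -/
theorem IsHermitianForm.fund_pow_flatMap (l : List (Cn n)) (h1 : ∀ v ∈ l, B v v = 1)
    (h2 : l.Pairwise fun u v => B u v = 0 ∧ B (mulI n u) v = 0) :
    (hB.fund ^ l.length) (l.flatMap fun v => [v, mulI n v]) = (l.length)! := by
  induction l with
  | nil => simp
  | cons v l ih =>
    rw [List.pairwise_cons] at h2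
    have ih := ih (fun u hu => h1 u (by simp [hu])) h2.2
    change Cochain.contr (mulI n v) (Cochain.contr v (hB.fund ^ (l.length + 1)))
      (l.flatMap fun v => [v, mulI n v]) = _
    have hc : Cochain.contr (mulI n v) (Cochain.contr v hB.fund) = 1 := by
      ext m
      cases m with
      | nil =>
        refine (hB.fund_pair v (mulI n v)).trans ?_
        rw [hB.inv, h1 v (by simp)]; simp
      | cons u m => exact hB.fund_of_ne (l := v :: mulI n v :: u :: m) (by simp)
    have hz : ∀ c : Cochain (Cn n),
        (Cochain.contr v hB.fund * c) (l.flatMap fun v => [v, mulI n v]) = 0 := by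
      refine fun c => Cochain.mul_apply_eq_zero (fun m hm => hB.fund_of_ne (by simpa using hm))
        (fun u hu => ?_) c
      refine (hB.fund_pair v u).trans ?_
      obtain ⟨t, ht, hu⟩ := List.mem_flatMap.1 hu
      obtain ⟨h3, h4⟩ := h2.1 t ht
      simp only [List.mem_cons, List.not_mem_nil, or_false] at hu
      rcases hu with rfl | rfl
      · exact h4
      · rw [hB.inv, h3]
    have hs : Cochain.sgn (Cochain.contr v hB.fund) = -Cochain.contr v hB.fund := by
      rw [← neg_eq_iff_eq_neg, ← Cochain.contr_sgn, hB.sgn_fund]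
    rw [Cochain.contr_pow hB.sgn_fund, map_smul, Cochain.contr_mul, hc, hs, one_mul,
      Nat.add_sub_cancel, Cochain.smul_apply, Cochain.add_apply, neg_mul, Cochain.neg_apply, hz, ih,
      List.length_cons, Nat.factorial_succ]
    push_cast
    ring

end Hermitian

/-! ### The volume form and the fundamental form -/

section Volume

variable {n : ℕ}

/-- The real basis `(b₁, i b₁, …, bₙ, i bₙ)` of a complex basis of `ℂⁿ`. -/
def realFrame (b : Module.Basis (Fin n) ℂ (Cn n)) : Module.Basis (Fin (2 * n)) ℝ (Cn n) :=
  (Complex.basisOneI.smulTower b).reindex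
    ((Equiv.prodComm (Fin 2) (Fin n)).trans
      (finProdFinEquiv.trans (finCongr (Nat.mul_comm n 2))))

theorem realFrame_mk (b : Module.Basis (Fin n) ℂ (Cn n)) (i : Fin n) (j : Fin 2)
    (h : 2 * (i : ℕ) + j < 2 * n) :
    realFrame b ⟨2 * i + j, h⟩ = Complex.basisOneI j • b i := by
  have h2 : (⟨2 * i + j, h⟩ : Fin (2 * n)) = ((Equiv.prodComm (Fin 2) (Fin n)).trans
      (finProdFinEquiv.trans (finCongr (Nat.mul_comm n 2)))) (j, i) := by
    ext; simp [finProdFinEquiv, add_comm]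
  rw [h2, realFrame, Module.Basis.reindex_apply, Equiv.symm_apply_apply,
    Module.Basis.smulTower_apply]

theorem ofFn_realFrame (b : Module.Basis (Fin n) ℂ (Cn n)) :
    List.ofFn (realFrame b) = (List.ofFn b).flatMap fun v => [v, mulI n v] := by
  rw [List.ofFn_mul', List.flatMap_def, List.map_ofFn]
  congr 2
  funext i
  have h0 := realFrame_mk b i 0 (by have := i.2; simp)
  have h1 := realFrame_mk b i 1 (by have := i.2; simp; omega)
  simp only [List.ofFn_succ, List.ofFn_zero, Function.comp_apply]
  refine congrArg₂ _ (h0.trans ?_) (congrArg₂ _ (h1.trans ?_) rfl)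
  · simp
  · simp [mulI]

/-- The real frames of complex bases are positively oriented. -/
theorem det_realFrame_pos (b : Module.Basis (Fin n) ℂ (Cn n)) :
    0 < (realBasis n).det (realFrame b) := by
  let f : Cn n ≃ₗ[ℂ] Cn n :=
    (EuclideanSpace.basisFun (Fin n) ℂ).toBasis.equiv b (Equiv.refl _)
  have hf : ⇑(realFrame b) = (f.toLinearMap.restrictScalars ℝ) ∘ realBasis n := by
    funext k
    obtain ⟨⟨j, i⟩, rfl⟩ := ((Equiv.prodComm (Fin 2) (Fin n)).trans
      (finProdFinEquiv.trans (finCongr (Nat.mul_comm n 2)))).surjective k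
    rw [Function.comp_apply, realFrame, realBasis, Module.Basis.reindex_apply,
      Module.Basis.reindex_apply, Equiv.symm_apply_apply, Module.Basis.smulTower_apply,
      Module.Basis.smulTower_apply]
    have h : f ((EuclideanSpace.basisFun (Fin n) ℂ).toBasis i) = b i :=
      Module.Basis.equiv_apply _ _ _ _
    rw [LinearMap.restrictScalars_apply, map_smul, LinearEquiv.coe_coe, h]
  rw [hf, Module.Basis.det_comp, Module.Basis.det_self, mul_one, LinearMap.det_restrictScalars,
    Algebra.norm_complex_apply]
  exact Complex.normSq_pos.2 f.isUnit_det'.ne_zero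

variable {B : Cn n →L[ℝ] Cn n →L[ℝ] ℝ} (hB : IsHermitianForm B)
include hB

theorem IsHermitianForm.realFrame_orthonormal {b : Module.Basis (Fin n) ℂ (Cn n)}
    (h1 : ∀ i j, B (b i) (b j) = if i = j then 1 else 0) (h2 : ∀ i j, B (mulI n (b i)) (b j) = 0)
    (k l : Fin (2 * n)) : B (realFrame b k) (realFrame b l) = if k = l then 1 else 0 := by
  obtain ⟨⟨j, i⟩, rfl⟩ := ((Equiv.prodComm (Fin 2) (Fin n)).trans
    (finProdFinEquiv.trans (finCongr (Nat.mul_comm n 2)))).surjective k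
  obtain ⟨⟨j', i'⟩, rfl⟩ := ((Equiv.prodComm (Fin 2) (Fin n)).trans
    (finProdFinEquiv.trans (finCongr (Nat.mul_comm n 2)))).surjective l
  rw [realFrame, Module.Basis.reindex_apply, Module.Basis.reindex_apply, Equiv.symm_apply_apply,
    Equiv.symm_apply_apply, Module.Basis.smulTower_apply, Module.Basis.smulTower_apply]
  simp only [Equiv.apply_eq_iff_eq]
  have hI : ∀ v : Cn n, Complex.I • v = mulI n v := fun v => rfl
  have h3 : ∀ i j, B (b i) (mulI n (b j)) = 0 := fun i j => by rw [hB.symm, h2]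
  fin_cases j <;> fin_cases j' <;> simp [hI, h1, h2, h3, hB.inv]

/-- The real frame of a unitary basis is orthonormal and positively oriented, so its volume is `1`. -/
theorem IsHermitianForm.sqrt_det_gram {b : Module.Basis (Fin n) ℂ (Cn n)}
    (h1 : ∀ i j, B (b i) (b j) = if i = j then 1 else 0)
    (h2 : ∀ i j, B (mulI n (b i)) (b j) = 0) :
    √(Matrix.of fun i j => B (realBasis n i) (realBasis n j)).det *
      (realBasis n).det (realFrame b) = 1 := by
  set G : Matrix (Fin (2 * n)) (Fin (2 * n)) ℝ :=
    Matrix.of fun i j => B (realBasis n i) (realBasis n j) with hG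
  have hp := det_realFrame_pos b
  set P := (realBasis n).toMatrix (realFrame b) with hP
  have hPG : P.transpose * G * P = 1 := by
    ext k l
    have hk : ∀ k, realFrame b k = ∑ i, P i k • realBasis n i := fun k =>
      ((realBasis n).sum_toMatrix_smul_self (realFrame b) k).symm
    have h3 := hB.realFrame_orthonormal h1 h2 k l
    rw [hk k, hk l] at h3
    simp only [map_sum, map_smul, _root_.sum_apply, _root_.smul_apply, smul_eq_mul] at h3
    rw [Matrix.one_apply, ← h3, Matrix.mul_apply]
    refine Finset.sum_congr rfl fun j _ => ?_
    rw [Matrix.mul_apply, mul_comm]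
    rfl
  have hd := congrArg Matrix.det hPG
  rw [Matrix.det_mul, Matrix.det_mul, Matrix.det_transpose, Matrix.det_one] at hd
  have hD : (realBasis n).det (realFrame b) = P.det := rfl
  rw [hD] at hp ⊢
  have : G.det = (P.det⁻¹) ^ 2 := by
    field_simp
    linarith
  rw [this, Real.sqrt_sq (by positivity)]
  field_simp

/-- The volume form in terms of the fundamental form: a `2n`-form whose cochain is the `n`-th power
of the fundamental form is `n!` times the volume form. -/
theorem IsHermitianForm.eq_vol_of_fund_pow {α : Cn n [⋀^Fin (2 * n)]→L[ℝ] ℝ}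
    (hα : toCochain α = hB.fund ^ n) :
    α = ((n ! : ℝ) * √(Matrix.of fun i j => B (realBasis n i) (realBasis n j)).det) •
      stdVol n := by
  obtain ⟨b, h1, h2⟩ := hB.exists_unitary_basis
  have hv : α (realFrame b) = n ! := by
    rw [← toCochain_ofFn, hα, ofFn_realFrame]
    have h := hB.fund_pow_flatMap (List.ofFn b) (fun v hv => ?_) ?_
    · rwa [List.length_ofFn] at h
    · obtain ⟨i, rfl⟩ := List.mem_ofFn.1 hv
      simp [h1]
    · rw [List.pairwise_ofFn]
      exact fun i j hij => ⟨by simp [h1, hij.ne], h2 i j⟩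
  refine ContinuousAlternatingMap.toAlternatingMap_injective ?_
  rw [(ContinuousAlternatingMap.toAlternatingMap _).eq_smul_basis_det (realFrame b), eq_comm,
    (ContinuousAlternatingMap.toAlternatingMap _).eq_smul_basis_det (realFrame b)]
  refine congrArg (· • (realFrame b).det) ?_
  have h3 : stdVol n (realFrame b) = (realBasis n).det (realFrame b) := rfl
  have h4 := hB.sqrt_det_gram h1 h2
  change (n ! : ℝ) * √_ * stdVol n (realFrame b) = α (realFrame b)
  rw [hv, h3, mul_assoc, h4, mul_one]

end Volume

/-! ### The Hodge star of a `1`-form and the Lee form -/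

section Codegree

variable {V : Type*} [AddCommGroup V] [Module ℝ V] {m : ℕ}

theorem curryLeft_sum_apply {ι : Type*} (α : V [⋀^Fin (m + 1)]→ₗ[ℝ] ℝ) (s : Finset ι) (X : ι → V)
    (v : Fin m → V) : α.curryLeft (∑ i ∈ s, X i) v = ∑ i ∈ s, α.curryLeft (X i) v := by
  induction s using Finset.cons_induction with
  | empty => simp only [Finset.sum_empty, map_zero, AlternatingMap.zero_apply]
  | cons i s hi ih =>
    rw [Finset.sum_cons, Finset.sum_cons, map_add, AlternatingMap.add_apply, ih]

/-- Every form of degree one less than the dimension is the contraction of a given nonzero top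
form with a vector. -/
theorem exists_curryLeft_eq (e : Module.Basis (Fin (m + 1)) ℝ V) {α : V [⋀^Fin (m + 1)]→ₗ[ℝ] ℝ}
    (hα : α e ≠ 0) (β : V [⋀^Fin m]→ₗ[ℝ] ℝ) : ∃ X, α.curryLeft X = β := by
  refine ⟨∑ j : Fin (m + 1), ((-1) ^ (j : ℕ) * β (j.removeNth e) / α e) • e j,
    Module.Basis.ext_alternating e fun f hf => ?_⟩
  -- `f` misses exactly one index `j`, so that it is `j.succAbove` up to a permutation
  obtain ⟨j, hj⟩ : ∃ j, ∀ k, f k ≠ j := by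
    by_contra! h
    have := Fintype.card_le_of_surjective f h
    simp at this
  have hex : ∀ k, ∃ l, j.succAbove l = f k := fun k => Fin.exists_succAbove_eq (hj k)
  choose σ hσ using hex
  have hσi : Function.Injective σ := fun a b hab => hf (by rw [← hσ, ← hσ, hab])
  let s : Equiv.Perm (Fin m) := Equiv.ofBijective σ (Finite.injective_iff_bijective.1 hσi)
  have hfe : (fun i => e (f i)) = (j.removeNth e) ∘ s := by
    funext k
    simp [s, Fin.removeNth, hσ]
  have hz : ∀ k, k ≠ j → α.curryLeft (e k) (fun i => e (f i)) = 0 := by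
    intro k hk
    obtain ⟨l, rfl⟩ := Fin.exists_succAbove_eq hk
    refine α.map_eq_zero_of_eq _ (i := 0) (j := (s.symm l).succ) ?_ (Fin.succ_ne_zero _).symm
    have h := congrFun hfe (s.symm l)
    simp only [Function.comp_apply, Equiv.apply_symm_apply] at h
    simpa [Fin.removeNth] using h.symm
  have hj' : α.curryLeft (e j) (j.removeNth e) = (-1) ^ (j : ℕ) * α e := by
    have h := α.neg_one_pow_smul_map_insertNth j (e j) (j.removeNth e)
    rw [Fin.insertNth_self_removeNth, zsmul_eq_mul] at h
    push_cast at h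
    exact h.symm
  have hsq : ((-1 : ℝ) ^ (j : ℕ)) * (-1) ^ (j : ℕ) = 1 := by rw [← mul_pow]; simp
  rw [curryLeft_sum_apply, Finset.sum_eq_single j]
  · rw [map_smul, AlternatingMap.smul_apply, hfe, AlternatingMap.map_perm, AlternatingMap.map_perm,
      hj', smul_eq_mul, Units.smul_def, Units.smul_def, zsmul_eq_mul, zsmul_eq_mul]
    field_simp
    linear_combination (β (j.removeNth e)) * hsq
  · intro k _ hk
    rw [map_smul, AlternatingMap.smul_apply, hz k hk, smul_zero]
  · simp

end Codegree

section Star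

variable {n : ℕ} {M : Type*} [TopologicalSpace M] [ChartedSpace (Cn n) M]
  [IsManifold 𝓘(ℂ, Cn n) ω M] (g : HermitianMetric n M)

namespace HermitianMetric

/-- The metric at a point, in the coordinates of the preferred chart. -/
def bilin (x : M) : Cn n →L[ℝ] Cn n →L[ℝ] ℝ := g.inner x

theorem isHermitianForm (x : M) : IsHermitianForm (g.bilin x) where
  symm := g.symm x
  pos := g.pos x
  inv := g.inner_cplxStr x

theorem sgn_co_fundamentalForm (x : M) :
    Cochain.sgn (g.fundamentalForm.co x) = g.fundamentalForm.co x :=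
  (g.isHermitianForm x).sgn_fund

theorem J_co_fundamentalForm (x : M) :
    Cochain.J (g.fundamentalForm.co x) = g.fundamentalForm.co x :=
  (g.isHermitianForm x).J_fund

theorem sqrt_det_gram_ne_zero (x : M) : √(g.gram x).det ≠ 0 := by
  obtain ⟨b, h1, h2⟩ := (g.isHermitianForm x).exists_unitary_basis
  exact left_ne_zero_of_mul_eq_one ((g.isHermitianForm x).sqrt_det_gram h1 h2)

/-- The identity `ωⁿ = n! vol`. -/
theorem pow_co_fundamentalForm (x : M) :
    g.fundamentalForm.co x ^ n = (n ! : ℝ) • g.vol.co x := by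
  have h := (g.isHermitianForm x).eq_vol_of_fund_pow (α := g.fundamentalForm.pow n x)
    (Form.co_pow g.fundamentalForm n x)
  rw [← Form.co_pow, ← Form.co_smul]
  refine congrArg (toCochain (V := Cn n)) (h.trans ?_)
  rw [mul_smul]
  rfl

/-- The vector dual to a `1`-form. -/
def sharp (θ : Form n M 1) (x : M) : Cn n :=
  ∑ i, ∑ j, ((g.gram x)⁻¹ i j * θ x (fun _ => realBasis n i)) • realBasis n j

theorem inner_sharp (θ : Form n M 1) (x : M) (v : Cn n) :
    g.bilin x (g.sharp θ x) v = θ.co x [v] := by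
  have hdet : IsUnit (g.gram x).det := by
    refine isUnit_iff_ne_zero.2 fun h => g.sqrt_det_gram_ne_zero x ?_
    rw [h, Real.sqrt_zero]
  let ℓ : Cn n →ₗ[ℝ] ℝ :=
    { toFun := fun v => θ.co x [v]
      map_add' := fun u v => by
        have h : ∀ u, θ.co x [u] = (show Cn n [⋀^Fin 1]→L[ℝ] ℝ from θ x).toAlternatingMap.curryLeft
          u ![] := fun u => toCochain_ofFn (V := Cn n) (θ x) ![u]
        simp only [h, map_add, AlternatingMap.add_apply]
      map_smul' := fun c v => by
        have h : ∀ u, θ.co x [u] = (show Cn n [⋀^Fin 1]→L[ℝ] ℝ from θ x).toAlternatingMap.curryLeft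
          u ![] := fun u => toCochain_ofFn (V := Cn n) (θ x) ![u]
        simp only [h, map_smul, AlternatingMap.smul_apply, RingHom.id_apply] }
  suffices h : (g.bilin x (g.sharp θ x)).toLinearMap = ℓ from LinearMap.congr_fun h v
  refine (realBasis n).ext fun k => ?_
  have hℓ : ∀ k, ℓ (realBasis n k) = θ x (fun _ => realBasis n k) := fun k =>
    toCochain_ofFn (V := Cn n) (θ x) (fun _ => realBasis n k)
  have hG : ∀ j, g.bilin x (realBasis n j) (realBasis n k) = g.gram x j k := fun j => rfl
  rw [hℓ, ContinuousLinearMap.coe_coe, sharp]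
  simp only [map_sum, map_smul, _root_.sum_apply, _root_.smul_apply, smul_eq_mul, hG]
  have hinv := Matrix.nonsing_inv_mul _ hdet
  have h1 : ∀ i, ∑ j, (g.gram x)⁻¹ i j * θ x (fun _ => realBasis n i) * g.gram x j k =
      (if i = k then 1 else 0) * θ x (fun _ => realBasis n i) := fun i => by
    rw [← Matrix.one_apply, ← hinv, Matrix.mul_apply, Finset.sum_mul]
    exact Finset.sum_congr rfl fun j _ => by ring
  rw [Finset.sum_congr rfl fun i _ => h1 i]
  simp

/-- The Hodge star of a `1`-form is the contraction of the volume form with the dual vector. -/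
theorem co_star {q : ℕ} (h : 2 * n = 1 + q) (θ : Form n M 1) (x : M) :
    (g.star h θ).co x = Cochain.contr (g.sharp θ x) (g.vol.co x) := by
  refine (Cochain.eq_ofFun (fun v => ?_) fun l hl => ?_).symm
  swap
  · exact toCochain_of_ne (V := Cn n) _ (by simp; omega)
  let ν : Cn n [⋀^Fin (q + 1)]→L[ℝ] ℝ := reindex (V := Cn n) (by omega) (g.vol x)
  have hν : ∀ u, g.vol.co x (u :: List.ofFn v) = ν.toAlternatingMap.curryLeft u v := fun u => by
    have hc : toCochain ν = g.vol.co x := toCochain_reindex (V := Cn n) _ (g.vol x)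
    rw [← List.ofFn_cons, ← hc]
    exact toCochain_ofFn ν _
  have happ : ∀ u : Cn n, g.vol.cast h x (Fin.append (fun _ => u) v) =
      ν.toAlternatingMap.curryLeft u v := fun u => by
    rw [← hν, ← Form.co_cast h]
    refine (toCochain_ofFn (V := Cn n) (g.vol.cast h x) (Fin.append (fun _ => u) v)).symm.trans ?_
    rw [List.ofFn_fin_append]
    rfl
  rw [Cochain.contr_apply, hν, sharp]
  simp only [curryLeft_sum_apply, map_smul, AlternatingMap.smul_apply, smul_eq_mul]
  have hs : g.star h θ x v = ((1 ! : ℕ) : ℝ)⁻¹ * ∑ i : Fin 1 → Fin (2 * n),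
      ∑ j : Fin 1 → Fin (2 * n),
        ((∏ a, (g.gram x)⁻¹ (i a) (j a)) * θ x (fun a => realBasis n (i a))) *
          g.vol.cast h x (Fin.append (fun a => realBasis n (j a)) v) := by
    have hsum : ∀ (c : ℝ) (F : (Fin 1 → Fin (2 * n)) → (Fin 1 → Fin (2 * n)) → ℝ)
        (A : (Fin 1 → Fin (2 * n)) → Cn n [⋀^Fin q]→L[ℝ] ℝ),
        (c • ∑ i, ∑ j, F i j • A j) v = c * ∑ i, ∑ j, F i j * A j v := fun c F A => by
      simp [ContinuousAlternatingMap.sum_apply]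
    exact hsum _ _ _
  refine Eq.trans ?_ hs.symm
  rw [Nat.factorial_one, Nat.cast_one, inv_one, one_mul]
  refine Fintype.sum_equiv (Equiv.funUnique (Fin 1) (Fin (2 * n))).symm _ _ fun i => ?_
  refine Fintype.sum_equiv (Equiv.funUnique (Fin 1) (Fin (2 * n))).symm _ _ fun j => ?_
  rw [← happ]
  simp

theorem contr_co_vol (x : M) (X : Cn n) (hn : n ≠ 0) : Cochain.contr X (g.vol.co x) =
    ((n - 1)! : ℝ)⁻¹ • (Cochain.contr X (g.fundamentalForm.co x) *
      g.fundamentalForm.co x ^ (n - 1)) := by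
  have h := congrArg (Cochain.contr X) (g.pow_co_fundamentalForm x)
  rw [Cochain.contr_pow (g.sgn_co_fundamentalForm x), map_smul] at h
  have hf : (n ! : ℝ) = n * (n - 1)! := by
    rw [← Nat.mul_factorial_pred hn]; push_cast; rfl
  have hn' : (n : ℝ) ≠ 0 := by exact_mod_cast hn
  rw [hf, mul_smul] at h
  rw [smul_right_injective _ hn' h, smul_smul, inv_mul_cancel₀ (by positivity), one_smul]

/-- The Hodge star of a `1`-form in terms of the complex structure and the fundamental form:
`(n-1)! ⋆θ = Jθ ∧ ω^(n-1)`. -/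
theorem co_star_eq {q : ℕ} (h : 2 * n = 1 + q) (θ : Form n M 1) (x : M) :
    (g.star h θ).co x = ((n - 1)! : ℝ)⁻¹ •
      (Cochain.J (θ.co x) * g.fundamentalForm.co x ^ (n - 1)) := by
  have hn : n ≠ 0 := by omega
  have hX : Cochain.contr (g.sharp θ x) (g.fundamentalForm.co x) = Cochain.J (θ.co x) := by
    ext l
    by_cases hl : l.length = 1
    · obtain ⟨v, rfl⟩ := List.length_eq_one_iff.1 hl
      have h1 := (g.isHermitianForm x).mulI_left (g.sharp θ x) v
      rw [inner_sharp] at h1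
      refine ((g.isHermitianForm x).fund_pair _ _).trans (h1.trans ?_)
      simp [Cochain.J, Cochain.comap]
    · refine ((g.isHermitianForm x).fund_of_ne (by simpa using hl)).trans ?_
      have h2 : θ.co x (l.map (mulI n)) = 0 := toCochain_of_ne (V := Cn n) _ (by simpa using hl)
      simp [Cochain.J, Cochain.comap, h2]
  rw [co_star, contr_co_vol g x _ hn, hX]

/-- The Lee form exists, by nondegeneracy of the fundamental form. -/
theorem isLeeForm_leeForm (hn : n ≠ 0) : g.IsLeeForm g.leeForm := by
  apply Classical.epsilon_spec (p := g.IsLeeForm)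
  have key : ∀ x, ∃ η : Cn n [⋀^Fin 1]→L[ℝ] ℝ, toCochain η * g.fundamentalForm.co x ^ (n - 1) =
      (g.fundamentalForm.pow (n - 1)).d.co x := by
    intro x
    have h1 : 2 * n = 2 * (n - 1) + 1 + 1 := by omega
    let ν : Cn n [⋀^Fin (2 * (n - 1) + 1 + 1)]→L[ℝ] ℝ := reindex (V := Cn n) h1 (g.vol x)
    have hc : toCochain ν = g.vol.co x := toCochain_reindex (V := Cn n) _ (g.vol x)
    let e := (realBasis n).reindex (finCongr h1)
    have hν : ν e ≠ 0 := by
      have h2 : ν e = g.vol x (realBasis n) := by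
        refine congrArg (g.vol x) (funext fun i => ?_)
        simp [e]
      have h3 : g.vol x (realBasis n) = √(g.gram x).det * (realBasis n).det (realBasis n) := rfl
      rw [h2, h3, Module.Basis.det_self, mul_one]
      exact g.sqrt_det_gram_ne_zero x
    let β : Cn n [⋀^Fin (2 * (n - 1) + 1)]→L[ℝ] ℝ := (g.fundamentalForm.pow (n - 1)).d x
    obtain ⟨X, hX⟩ := exists_curryLeft_eq e (α := ν.toAlternatingMap) hν β.toAlternatingMap
    let W : Cn n [⋀^Fin 2]→L[ℝ] ℝ := g.fundamentalForm x
    refine ⟨((n - 1)! : ℝ)⁻¹ • W.curryLeft X, ?_⟩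
    have h4 : Cochain.contr X (g.fundamentalForm.co x) = toCochain (W.curryLeft X) :=
      Cochain.contr_ofFun_succ _ X
    have h5 : Cochain.contr X (g.vol.co x) = (g.fundamentalForm.pow (n - 1)).d.co x := by
      rw [← hc]
      refine (Cochain.contr_ofFun_succ _ X).trans ?_
      exact congrArg (Cochain.ofFun _) (congrArg DFunLike.coe hX)
    rw [toCochain_smul, smul_mul_assoc, ← h4, ← contr_co_vol g x X hn, h5]
  choose η hη using key
  let θ : Form n M 1 := η
  refine ⟨θ, Form.ext_co fun x => ?_⟩
  rw [Form.co_cast, Form.co_wedge, Form.co_pow]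
  exact (hη x).symm

theorem co_d_pow_eq_lee (hn : n ≠ 0) (x : M) : (g.fundamentalForm.pow (n - 1)).d.co x =
    g.leeForm.co x * g.fundamentalForm.co x ^ (n - 1) := by
  have h := g.isLeeForm_leeForm hn
  rw [IsLeeForm] at h
  rw [h, Form.co_cast, Form.co_wedge, Form.co_pow]

end HermitianMetric

end Star

/-! ### The `k`-Gauduchon condition -/

namespace HermitianMetric

variable {n : ℕ} {M : Type*} [TopologicalSpace M] [ChartedSpace (Cn n) M]
  [IsManifold 𝓘(ℂ, Cn n) ω M] (g : HermitianMetric n M)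

/-- The `2n`-form `dJdω ∧ ω^(n-2)`, as a cochain. -/
def secondOrderTerm (x : M) : Cochain (Cn n) :=
  g.fundamentalForm.d.J.d.co x * g.fundamentalForm.co x ^ (n - 2)

/-- The `2n`-form `Jdω ∧ dω ∧ ω^(n-3)`, as a cochain. -/
def firstOrderTerm (x : M) : Cochain (Cn n) :=
  g.fundamentalForm.d.J.co x * g.fundamentalForm.d.co x * g.fundamentalForm.co x ^ (n - 3)

/-- The exterior derivative of a form with the values of `c • Jdω ∧ ω^k`. -/
theorem co_d_of_co_eq {p : ℕ} {α : Form n M p} {c : ℝ} {k : ℕ}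
    (h : ∀ x, α.co x = c • (g.fundamentalForm.d.J.co x * g.fundamentalForm.co x ^ k)) (x : M) :
    α.d.co x = c • (g.fundamentalForm.d.J.d.co x * g.fundamentalForm.co x ^ k -
      (k : ℝ) • (g.fundamentalForm.d.J.co x * g.fundamentalForm.d.co x *
        g.fundamentalForm.co x ^ (k - 1))) := by
  have hs := g.smooth_fundamentalForm
  simp only [← Form.co_pow _ k] at h
  rw [Form.co_d_of_co_eq hs.diff_d.J (hs.diff.pow k) h, Form.co_d_pow hs.diff, Form.sgn_co,
    Form.co_pow, mul_smul_comm, smul_mul_assoc, sub_eq_add_neg, ← smul_neg, mul_assoc]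
  congr 3
  norm_num

theorem co_J_d_pow (k : ℕ) (x : M) : Cochain.J ((g.fundamentalForm.pow k).d.co x) =
    (k : ℝ) • (g.fundamentalForm.d.J.co x * g.fundamentalForm.co x ^ (k - 1)) := by
  rw [Form.co_d_pow g.smooth_fundamentalForm.diff, Cochain.J_smul, Cochain.J_mul, Cochain.J_pow,
    g.J_co_fundamentalForm, Form.co_J]

/-- On powers of the fundamental form, `d^c` is `J d`. -/
theorem co_dc_pow (k : ℕ) (x : M) : (g.fundamentalForm.pow k).dc.co x =
    (k : ℝ) • (g.fundamentalForm.d.J.co x * g.fundamentalForm.co x ^ (k - 1)) := by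
  have hJ : (g.fundamentalForm.pow k).J = g.fundamentalForm.pow k := Form.ext_co fun x => by
    rw [Form.co_J, Form.co_pow, Cochain.J_pow, g.J_co_fundamentalForm]
  rw [← co_J_d_pow]
  refine (Form.co_neg _ x).trans ?_
  rw [Form.co_Jinv, hJ, pow_succ, pow_mul]
  simp

theorem co_d_dc_pow (k : ℕ) (x : M) : (g.fundamentalForm.pow k).dc.d.co x =
    (k : ℝ) • (g.fundamentalForm.d.J.d.co x * g.fundamentalForm.co x ^ (k - 1) -
      ((k - 1 : ℕ) : ℝ) • (g.fundamentalForm.d.J.co x * g.fundamentalForm.d.co x *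
        g.fundamentalForm.co x ^ (k - 1 - 1))) :=
  g.co_d_of_co_eq (g.co_dc_pow k) x

/-- Here `dd^c ω^k ∧ ω^(n-k-1)` is `k` times the difference of the two sides. -/
theorem isKGauduchon_iff {k : ℕ} (hk : 1 ≤ k) (hkn : k ≤ n - 1) :
    g.IsKGauduchon k ↔ ∀ x, g.secondOrderTerm x = ((k : ℝ) - 1) • g.firstOrderTerm x := by
  have hco : ∀ x, (((g.fundamentalForm.pow k).dc.d.wedge (g.fundamentalForm.pow (n - k - 1)))).co x
      = (k : ℝ) • (g.secondOrderTerm x - ((k : ℝ) - 1) • g.firstOrderTerm x) := fun x => by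
    rw [Form.co_wedge, co_d_dc_pow, Form.co_pow, smul_mul_assoc, sub_mul, smul_mul_assoc, mul_assoc,
      mul_assoc (_ * _), ← pow_add, ← pow_add, secondOrderTerm, firstOrderTerm,
      show k - 1 + (n - k - 1) = n - 2 by omega]
    rcases hk.eq_or_lt with rfl | hk
    · simp
    · rw [show k - 1 - 1 + (n - k - 1) = n - 3 by omega, Nat.cast_sub hk.le, Nat.cast_one]
  have hk0 : (k : ℝ) ≠ 0 := by positivity
  constructor
  · intro h x
    have h1 := hco x
    rw [IsKGauduchon] at h
    rw [h, Form.co_zero] at h1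
    exact sub_eq_zero.1 ((smul_eq_zero_iff_right hk0).1 h1.symm)
  · intro h
    refine Form.ext_co fun x => ?_
    rw [hco, h, sub_self, smul_zero, Form.co_zero]

/-- The formula `(n-2)! d⋆θ = dJdω ∧ ω^(n-2) - (n-2) Jdω ∧ dω ∧ ω^(n-3)`. -/
theorem co_d_star_leeForm {q : ℕ} (hn : 2 ≤ n) (h : 2 * n = 1 + q) (x : M) :
    ((n - 2)! : ℝ) • (g.star h g.leeForm).d.co x =
      g.secondOrderTerm x - ((n : ℝ) - 2) • g.firstOrderTerm x := by
  have hc : ∀ x, (g.star h g.leeForm).co x = (((n - 1)! : ℝ)⁻¹ * (n - 1 : ℕ)) •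
      (g.fundamentalForm.d.J.co x * g.fundamentalForm.co x ^ (n - 2)) := fun x => by
    have h1 : Cochain.J (g.leeForm.co x) * g.fundamentalForm.co x ^ (n - 1) =
        Cochain.J ((g.fundamentalForm.pow (n - 1)).d.co x) := by
      rw [g.co_d_pow_eq_lee (by omega), Cochain.J_mul, Cochain.J_pow, g.J_co_fundamentalForm]
    rw [co_star_eq, h1, co_J_d_pow, smul_smul]
    rfl
  have hf : ((n - 2)! : ℝ) * (((n - 1)! : ℝ)⁻¹ * (n - 1 : ℕ)) = 1 := by
    obtain ⟨m, rfl⟩ : ∃ m, n = m + 2 := ⟨n - 2, by omega⟩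
    rw [show m + 2 - 1 = m + 1 by omega, Nat.add_sub_cancel, Nat.factorial_succ]
    push_cast
    field_simp
  rw [g.co_d_of_co_eq hc, smul_smul, hf, one_smul, Nat.cast_sub hn, Nat.cast_two]
  rfl

theorem isGauduchon_of_isKGauduchon (h : g.IsKGauduchon (n - 1)) : g.IsGauduchon := by
  refine Form.ext_co fun x => ?_
  have h1 : (((g.fundamentalForm.pow (n - 1)).dc.d.wedge
      (g.fundamentalForm.pow (n - (n - 1) - 1)))).co x = 0 := by
    rw [IsKGauduchon] at h
    rw [h, Form.co_zero]
  rw [Form.co_wedge, Form.co_pow, show n - (n - 1) - 1 = 0 by omega, pow_zero, mul_one] at h1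
  rw [h1, Form.co_zero]

end HermitianMetric

end KGauduchon

end

theorem proposition3p1 (n : ℕ) (hn : 2 < n) {M : Type*} [TopologicalSpace M]
    [ChartedSpace (KGauduchon.Cn n) M] [IsManifold 𝓘(ℂ, KGauduchon.Cn n) ω M]
    [CompactSpace M] [T2Space M] (g : KGauduchon.HermitianMetric n M) :
    (∀ k : ℕ, 1 ≤ k → k ≤ n - 1 →
      (g.IsKGauduchon k ↔
        ((n : ℝ) - k - 1) • (g.fundamentalForm.d.J.d.wedge (g.fundamentalForm.pow (n - 2))).cast
            (show 2 + 1 + 1 + 2 * (n - 2) = 2 * n by omega) =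
          (-((k : ℝ) - 1) * ((n - 2)! : ℝ)) •
            (g.star (show 2 * n = 1 + (2 * n - 1) by omega) g.leeForm).d.cast
              (show 2 * n - 1 + 1 = 2 * n by omega))) ∧
    (∀ k₁ k₂ : ℕ, 1 ≤ k₁ → k₁ ≤ n - 1 → 1 ≤ k₂ → k₂ ≤ n - 1 → k₁ ≠ k₂ →
      g.IsKGauduchon k₁ → g.IsKGauduchon k₂ →
        (∀ k : ℕ, 1 ≤ k → k ≤ n - 1 → g.IsKGauduchon k) ∧ g.IsGauduchon) := by
  refine ⟨fun k hk hkn => ?_, fun k₁ k₂ h1 h1n h2 h2n hne hg1 hg2 => ?_⟩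
  · rw [g.isKGauduchon_iff hk hkn]
    have hn2 : (n : ℝ) - 2 ≠ 0 := by
      have : (2 : ℝ) < n := by exact_mod_cast hn
      linarith
    have hL : ∀ x, (((n : ℝ) - k - 1) •
        (g.fundamentalForm.d.J.d.wedge (g.fundamentalForm.pow (n - 2))).cast
          (show 2 + 1 + 1 + 2 * (n - 2) = 2 * n by omega)).co x =
        ((n : ℝ) - k - 1) • g.secondOrderTerm x := fun x => by
      rw [KGauduchon.Form.co_smul, KGauduchon.Form.co_cast, KGauduchon.Form.co_wedge,
        KGauduchon.Form.co_pow]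
      rfl
    have hR : ∀ x, ((-((k : ℝ) - 1) * ((n - 2)! : ℝ)) •
        (g.star (show 2 * n = 1 + (2 * n - 1) by omega) g.leeForm).d.cast
          (show 2 * n - 1 + 1 = 2 * n by omega)).co x =
        (-((k : ℝ) - 1)) • (g.secondOrderTerm x - ((n : ℝ) - 2) • g.firstOrderTerm x) := fun x => by
      rw [KGauduchon.Form.co_smul, KGauduchon.Form.co_cast, mul_smul, g.co_d_star_leeForm hn.le]
    -- both conditions say that `(n-2) (A - (k-1) B) = 0` for the two terms `A`, `B`
    have hkey : ∀ x, ((n : ℝ) - k - 1) • g.secondOrderTerm x -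
        (-((k : ℝ) - 1)) • (g.secondOrderTerm x - ((n : ℝ) - 2) • g.firstOrderTerm x) =
        ((n : ℝ) - 2) • (g.secondOrderTerm x - ((k : ℝ) - 1) • g.firstOrderTerm x) := fun x => by
      module
    constructor
    · intro h
      refine KGauduchon.Form.ext_co fun x => ?_
      rw [hL, hR, ← sub_eq_zero, hkey, h, sub_self, smul_zero]
    · intro h x
      have h' := hkey x
      rw [← hL, ← hR, h, sub_self] at h'
      exact sub_eq_zero.1 ((smul_eq_zero_iff_right hn2).1 h'.symm)
  · rw [g.isKGauduchon_iff h1 h1n] at hg1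
    rw [g.isKGauduchon_iff h2 h2n] at hg2
    have hne' : (k₁ : ℝ) - k₂ ≠ 0 := sub_ne_zero.2 (by exact_mod_cast hne)
    have hB : ∀ x, g.firstOrderTerm x = 0 := fun x => by
      have h : ((k₁ : ℝ) - k₂) • g.firstOrderTerm x = 0 := by
        have h3 := (hg1 x).symm.trans (hg2 x)
        rw [← sub_eq_zero] at h3
        rw [← h3]
        module
      exact (smul_eq_zero_iff_right hne').1 h
    have hall : ∀ k : ℕ, 1 ≤ k → k ≤ n - 1 → g.IsKGauduchon k := fun k hk hkn => by
      rw [g.isKGauduchon_iff hk hkn]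
      intro x
      rw [hg1, hB, smul_zero, smul_zero]
    exact ⟨hall, g.isGauduchon_of_isKGauduchon (hall (n - 1) (by omega) le_rfl)⟩
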